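/- An arrangement of $n$ orthogonal circles is a set $\mathcal A$ of $n$ distinct circles (of positive radius) in the Euclidean plane $\mathbb R^2$ such that any two distinct circles of $\mathcal A$ that intersect do so at right angles, i.e. their tangent lines are perpendicular at each common point. A face of $\mathcal A$ is a connected component of $\mathbb R^2\setminus\bigcup\mathcal A$. A vertex of $\mathcal A$ is a point that lies on two distinct circles of $\mathcal A$, and an edge is a connected component of $\bigcup\mathcal A$ minus the set of vertices (so a circle of $\mathcal A$ that meets no other circle of $\mathcal A$ is a single edge). A face is called digonal (respectively triangular) if it is bounded by exactly two (respectively three) edges, that is, if exactly two (respectively three) edges are contained in its topological boundary. **Theorem.** Every arrangement of $n$ orthogonal circles has at most $2n$ digonal faces and at most $4n$ triangular faces. -/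

import Mathlib

namespace CircleArrangement

/-- The Euclidean plane. -/
abbrev Plane : Type := EuclideanSpace ℝ (Fin 2)

/-- A circle in the plane, given by its center and radius (positivity of the radius is
required of arrangements below). -/
abbrev Circ : Type := EuclideanGeometry.Sphere Plane

/-- Two circles meet only at right angles: at every common point their tangent lines are
perpendicular. (Vacuous for disjoint circles. `orthRadius p` is the tangent line at `p`.) -/
def MeetAtRightAngles (α β : Circ) : Prop :=
  ∀ p : Plane, p ∈ α → p ∈ β →
    (α.orthRadius p).direction ⟂ (β.orthRadius p).direction

/-- An arrangement of orthogonal circles: a finite set of circles of positive radius such that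
each intersecting pair of distinct circles intersects at right angles. -/
structure IsOrthogonal (A : Finset Circ) : Prop where
  radius_pos : ∀ α ∈ A, 0 < α.radius
  right_angles : ∀ α ∈ A, ∀ β ∈ A, α ≠ β → MeetAtRightAngles α β

/-- The union of the circles of the arrangement. -/
def skeleton (A : Finset Circ) : Set Plane :=
  {p | ∃ α ∈ A, p ∈ α}

/-- The vertices: points lying on two distinct circles of the arrangement. -/
def vertices (A : Finset Circ) : Set Plane :=
  {p | ∃ α ∈ A, ∃ β ∈ A, α ≠ β ∧ p ∈ α ∧ p ∈ β}

/-- A face: a connected component of the complement of the union of the circles. -/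
def IsFace (A : Finset Circ) (F : Set Plane) : Prop :=
  ∃ x ∈ (skeleton A)ᶜ, F = connectedComponentIn (skeleton A)ᶜ x

/-- An edge: a connected component of the union of the circles with the vertices removed, that is,
an open arc between consecutive vertices of a circle, or a whole circle that has no vertices. -/
def IsEdge (A : Finset Circ) (e : Set Plane) : Prop :=
  ∃ x ∈ skeleton A \ vertices A, e = connectedComponentIn (skeleton A \ vertices A) x

/-- The edges that bound a set `F`: those lying on its topological boundary. -/
def boundingEdges (A : Finset Circ) (F : Set Plane) : Set (Set Plane) :=
  {e | IsEdge A e ∧ e ⊆ frontier F}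

/-- The digonal faces: those bounded by exactly two edges. -/
def digonalFaces (A : Finset Circ) : Set (Set Plane) :=
  {F | IsFace A F ∧ (boundingEdges A F).encard = 2}

/-- The triangular faces: those bounded by exactly three edges. -/
def triangularFaces (A : Finset Circ) : Set (Set Plane) :=
  {F | IsFace A F ∧ (boundingEdges A F).encard = 3}

end CircleArrangement

namespace CircleArrangement

open Set Topology Real MeasureTheory
open scoped RealInnerProductSpace

/-! Each circle offers an angle `2π` on its inner side, `2πn` in all, and every face with few edges
uses up a definite share. For a bounded face `F` and each direction `t`, a point of the closure of
`F` that is extreme in direction `t` is either a vertex or the point `pt α t` of a circle `α` that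
has `F` inside (`IsFace.exists_normal`). The corners of `F` are right angles, so one vertex is
extreme for directions of measure at most `π/2` (`IsFace.volume_vertex_le`). A face with `k` edges
has at most `k` vertices (`IsFace.ncard_vertices_le`), so its arcs seen from inside have total angle
at least `2π - kπ/2` (`IsFace.two_pi_le`): `π` for digons, `π/2` for triangles. Arcs of different
faces on the inner side of one circle are disjoint (`IsOrthogonal.sum_normals_le`), and division
gives `2n` and `4n`. Supporting lines replace the turning of the boundary, so faces need not be
simply connected.

The unbounded face may itself be counted, and it has no such bound. Instead its boundary has total
angle greater than `2π` (`IsFace.two_pi_lt`), and the inner sides of those arcs belong to at most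
`k` neighboring faces. Discarding the unbounded face and these neighbors loses at most `k + 1` faces
but frees more than `2π` of the budget, which is enough for both bounds (`IsOrthogonal.card_bound`).
-/

/-! ### Powers of points as local coordinates. -/

theorem inner_eq_coord (x y : Plane) : ⟪x, y⟫ = x 0 * y 0 + x 1 * y 1 := by
  simp [PiLp.inner_apply, Fin.sum_univ_two, mul_comm]

/-- In the plane, a vector orthogonal to two orthogonal nonzero vectors vanishes. -/
theorem eq_zero_of_inner_eq_zero {a b w : Plane} (ha : a ≠ 0) (hb : b ≠ 0) (hab : ⟪a, b⟫ = 0)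
    (h1 : ⟪a, w⟫ = 0) (h2 : ⟪b, w⟫ = 0) : w = 0 := by
  have hd : a 0 * b 1 - a 1 * b 0 ≠ 0 := by
    intro h
    have ha' : 0 < ⟪a, a⟫ := real_inner_self_pos.2 ha
    have hb' : 0 < ⟪b, b⟫ := real_inner_self_pos.2 hb
    rw [inner_eq_coord] at *
    -- Lagrange's identity: the squared determinant plus `⟪a, b⟫ ^ 2` is the product of the squared
    -- norms.
    nlinarith [mul_pos ha' hb']
  rw [inner_eq_coord] at h1 h2
  ext i
  fin_cases i
  · have : (a 0 * b 1 - a 1 * b 0) * w 0 = 0 := by linear_combination b 1 * h1 - a 1 * h2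
    simpa [hd] using this
  · have : (a 0 * b 1 - a 1 * b 0) * w 1 = 0 := by linear_combination a 0 * h2 - b 0 * h1
    simpa [hd] using this

/-- The power of a point with respect to a circle. -/
noncomputable def power (α : Circ) (x : Plane) : ℝ := ‖x - α.center‖ ^ 2 - α.radius ^ 2

theorem power_eq_zero_iff {α : Circ} (h : 0 < α.radius) {x : Plane} : power α x = 0 ↔ x ∈ α := by
  rw [EuclideanGeometry.mem_sphere, dist_eq_norm, power, sub_eq_zero,
    sq_eq_sq₀ (norm_nonneg _) h.le]

theorem continuous_power (α : Circ) : Continuous (power α) := by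
  unfold power; fun_prop

theorem hasStrictFDerivAt_power (α : Circ) (p : Plane) :
    HasStrictFDerivAt (power α) ((2 : ℝ) • innerSL ℝ (p - α.center)) p := by
  have h1 : HasStrictFDerivAt (fun x : Plane => x - α.center) (ContinuousLinearMap.id ℝ Plane) p :=
    (hasStrictFDerivAt_id p).sub_const _
  have := ((hasStrictFDerivAt_norm_sq (p - α.center)).comp p h1).sub_const (α.radius ^ 2)
  rw [ContinuousLinearMap.comp_id, ← Nat.cast_smul_eq_nsmul ℝ, Nat.cast_ofNat] at this
  exact this

/-- Two circles that cross at right angles at `p` provide local coordinates there. -/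
theorem exists_chart {α β : Circ} {p : Plane} (hα : p ≠ α.center) (hβ : p ≠ β.center)
    (hab : ⟪p - α.center, p - β.center⟫ = 0) (hpα : power α p = 0) (hpβ : power β p = 0)
    {W : Set Plane} (hW : W ∈ 𝓝 p) :
    ∃ U : Set Plane, IsOpen U ∧ p ∈ U ∧ U ⊆ W ∧
      (∀ C : Set (ℝ × ℝ), Convex ℝ C →
        IsPreconnected (U ∩ (fun x => (power α x, power β x)) ⁻¹' C)) ∧
      ∀ C : Set (ℝ × ℝ), ∀ q ∈ U, (power α q, power β q) ∈ closure C →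
        q ∈ closure (U ∩ (fun x => (power α x, power β x)) ⁻¹' C) := by
  set Φ : Plane → ℝ × ℝ := fun x => (power α x, power β x) with hΦ
  have hd := (hasStrictFDerivAt_power α p).prodMk (hasStrictFDerivAt_power β p)
  set D := ((2 : ℝ) • innerSL ℝ (p - α.center)).prod ((2 : ℝ) • innerSL ℝ (p - β.center)) with hD
  have hinj : Function.Injective D.toLinearMap := by
    rw [← LinearMap.ker_eq_bot, LinearMap.ker_eq_bot']
    intro w hw
    have hw1 : D w = 0 := hw
    simp only [hD, ContinuousLinearMap.prod_apply, Prod.mk_eq_zero] at hw1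
    exact eq_zero_of_inner_eq_zero (sub_ne_zero.2 hα) (sub_ne_zero.2 hβ) hab
      (by simpa [inner_sub_left] using hw1.1) (by simpa [inner_sub_left] using hw1.2)
  have hfr : Module.finrank ℝ Plane = Module.finrank ℝ (ℝ × ℝ) := by simp
  let E : Plane ≃L[ℝ] ℝ × ℝ := (LinearEquiv.ofInjectiveOfFinrankEq D.toLinearMap hinj
    hfr).toContinuousLinearEquiv
  have hE : (E : Plane →L[ℝ] ℝ × ℝ) = D := by ext w <;> rfl
  have hd' : HasStrictFDerivAt Φ (E : Plane →L[ℝ] ℝ × ℝ) p := by rw [hE]; exact hd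
  set e := hd'.toOpenPartialHomeomorph Φ with he
  have hps : p ∈ e.source := hd'.mem_toOpenPartialHomeomorph_source
  have hcoe : ∀ x, e x = Φ x := fun x => rfl
  have hΦp : Φ p = 0 := by simp [hΦ, hpα, hpβ]
  have h0t : (0 : ℝ × ℝ) ∈ e.target := by
    rw [← hΦp]; exact hd'.image_mem_toOpenPartialHomeomorph_target
  have hs0 : e.symm 0 = p := by rw [← hΦp, ← hcoe]; exact e.left_inv hps
  have hpre : e.target ∩ e.symm ⁻¹' W ∈ 𝓝 (0 : ℝ × ℝ) := by
    refine Filter.inter_mem (e.open_target.mem_nhds h0t) ?_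
    exact (e.continuousAt_symm h0t) (by rw [hs0]; exact hW)
  obtain ⟨δ, hδ, hball⟩ := Metric.mem_nhds_iff.1 hpre
  have hbt : Metric.ball (0 : ℝ × ℝ) δ ⊆ e.target := fun y hy => (hball hy).1
  -- With `U` the preimage of a small ball, connectedness and closure questions in `U` become
  -- questions about the convex set `ball ∩ C`.
  have himg : ∀ C, (e.source ∩ Φ ⁻¹' (Metric.ball 0 δ)) ∩ Φ ⁻¹' C =
      e.symm '' (Metric.ball 0 δ ∩ C) := by
    intro C
    ext x
    constructor
    · rintro ⟨⟨hx, hx1⟩, hx2⟩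
      exact ⟨Φ x, ⟨hx1, hx2⟩, e.left_inv hx⟩
    · rintro ⟨y, ⟨hy1, hy2⟩, rfl⟩
      have : Φ (e.symm y) = y := e.right_inv (hbt hy1)
      refine ⟨⟨e.map_target (hbt hy1), ?_⟩, ?_⟩ <;> simpa only [mem_preimage, this]
  refine ⟨e.source ∩ Φ ⁻¹' (Metric.ball 0 δ), ?_, ⟨hps, ?_⟩, ?_, ?_, ?_⟩
  · exact e.isOpen_inter_preimage Metric.isOpen_ball
  · simp [hΦp, hδ]
  · rintro x ⟨hx, hx1⟩
    have := (hball hx1).2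
    rwa [mem_preimage, ← hcoe, e.left_inv hx] at this
  · intro C hC
    rw [himg]
    exact ((convex_ball _ _).inter hC).isPreconnected.image _
      (e.continuousOn_symm.mono fun y hy => hbt hy.1)
  · intro C q hq hqC
    rw [himg, ← e.left_inv hq.1]
    have hc : ContinuousAt e.symm (e q) := e.continuousAt_symm (hbt hq.2)
    refine mem_closure_image hc ?_
    exact Metric.isOpen_ball.inter_closure ⟨hq.2, hqC⟩

/-! ### Orthogonal radii and the finiteness of the vertices. -/

/-- Rotation by a right angle. -/
noncomputable def rot (x : Plane) : Plane := !₂[-x 1, x 0]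

theorem inner_rot_self (x : Plane) : ⟪x, rot x⟫ = 0 := by
  rw [inner_eq_coord]; simp [rot]; ring

theorem norm_rot (x : Plane) : ‖rot x‖ = ‖x‖ := by
  rw [← sq_eq_sq₀ (norm_nonneg _) (norm_nonneg _), ← real_inner_self_eq_norm_sq,
    ← real_inner_self_eq_norm_sq, inner_eq_coord, inner_eq_coord]
  simp [rot]; ring

/-- Radii of orthogonal circles to a common point are orthogonal. -/
theorem MeetAtRightAngles.inner_eq_zero {α β : Circ} (h : MeetAtRightAngles α β) {p : Plane}
    (hα : p ∈ α) (hβ : p ∈ β) (hr : 0 < α.radius) :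
    ⟪p - α.center, p - β.center⟫ = 0 := by
  have h1 := h p hα hβ
  rw [EuclideanGeometry.Sphere.direction_orthRadius, EuclideanGeometry.Sphere.direction_orthRadius,
    Submodule.isOrtho_iff_le, Submodule.orthogonal_orthogonal] at h1
  -- The rotated radius is tangent to `α`, and perpendicular tangents put it on the line of the
  -- radius of `β`.
  have h2 : rot (p - α.center) ∈ (Submodule.span ℝ {p -ᵥ α.center})ᗮ := by
    rw [Submodule.mem_orthogonal_singleton_iff_inner_right]
    exact inner_rot_self _
  obtain ⟨l, hl⟩ := Submodule.mem_span_singleton.1 (h1 h2)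
  have h3 := inner_rot_self (p - α.center)
  rw [← hl] at h3
  have h4 : l ≠ 0 := by
    rintro rfl
    have := norm_rot (p - α.center)
    rw [← hl, ← dist_eq_norm, EuclideanGeometry.mem_sphere.1 hα] at this
    simp at this
    exact hr.ne this
  rw [inner_smul_right] at h3
  simpa [h4] using h3

theorem ne_center_of_mem {α : Circ} {p : Plane} (hα : p ∈ α) (hr : 0 < α.radius) :
    p ≠ α.center := by
  rintro h
  have := EuclideanGeometry.mem_sphere.1 hα
  rw [h, dist_self] at this
  exact hr.ne this

theorem IsOrthogonal.inner_eq_zero {A : Finset Circ} (hA : IsOrthogonal A) {α β : Circ} (hα : α ∈ A)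
    (hβ : β ∈ A) (hne : α ≠ β) {p : Plane} (hpα : p ∈ α) (hpβ : p ∈ β) :
    ⟪p - α.center, p - β.center⟫ = 0 :=
  (hA.right_angles α hα β hβ hne).inner_eq_zero hpα hpβ (hA.radius_pos α hα)

/-- At most two circles of an orthogonal arrangement pass through a point. -/
theorem IsOrthogonal.eq_or_eq_of_mem {A : Finset Circ} (hA : IsOrthogonal A) {α β γ : Circ}
    (hα : α ∈ A) (hβ : β ∈ A) (hγ : γ ∈ A) (hne : α ≠ β) {p : Plane} (hpα : p ∈ α) (hpβ : p ∈ β)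
    (hpγ : p ∈ γ) : γ = α ∨ γ = β := by
  by_contra! h
  exact sub_ne_zero.2 (ne_center_of_mem hpγ (hA.radius_pos γ hγ)) <| eq_zero_of_inner_eq_zero
    (sub_ne_zero.2 (ne_center_of_mem hpα (hA.radius_pos α hα)))
    (sub_ne_zero.2 (ne_center_of_mem hpβ (hA.radius_pos β hβ)))
    (hA.inner_eq_zero hα hβ hne hpα hpβ) (hA.inner_eq_zero hα hγ h.1.symm hpα hpγ)
    (hA.inner_eq_zero hβ hγ h.2.symm hpβ hpγ)

theorem finite_vertices (A : Finset Circ) : (vertices A).Finite := by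
  have h : vertices A ⊆ ⋃ α ∈ (A : Set Circ), ⋃ β ∈ (A : Set Circ),
      {p | α ≠ β ∧ p ∈ α ∧ p ∈ β} := by
    rintro p ⟨α, hα, β, hβ, h⟩
    simp only [mem_iUnion]
    exact ⟨α, hα, β, hβ, h⟩
  refine Finite.subset (A.finite_toSet.biUnion fun α _ => A.finite_toSet.biUnion fun β _ => ?_) h
  by_contra hinf
  obtain ⟨s, hs, hc⟩ := Set.Infinite.exists_subset_card_eq hinf 3
  obtain ⟨x, y, z, hxy, hxz, hyz, rfl⟩ := Finset.card_eq_three.1 hc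
  obtain ⟨h1, h2, h3⟩ := hs (show x ∈ _ by simp)
  obtain ⟨-, h4, h5⟩ := hs (show y ∈ _ by simp)
  obtain ⟨-, h6, h7⟩ := hs (show z ∈ _ by simp)
  rcases EuclideanGeometry.eq_of_mem_sphere_of_mem_sphere_of_finrank_eq_two (by simp) h1 hxy
    h2 h4 h6 h3 h5 h7 with h | h
  · exact hxz h.symm
  · exact hyz h.symm

/-- No circle passes through a point strictly inside a triangle inscribed in it. -/
theorem not_mem_of_interior_triangle {α : Circ} {x y z q : Plane} (hx : x ∈ α) (hy : y ∈ α)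
    (hz : z ∈ α) (hxy : x ≠ y) {a b c : ℝ} (ha : 0 < a) (hb : 0 < b) (hc : 0 < c)
    (habc : a + b + c = 1) (hq : q = a • x + b • y + c • z) : q ∉ α := by
  intro hqα
  rw [EuclideanGeometry.mem_sphere, dist_eq_norm] at *
  -- Strict convexity puts the combination of `x` and `y` strictly inside the circle; mixing in `z`
  -- cannot bring it back to the circle.
  have h1 : ‖(a / (a + b)) • (x - α.center) + (b / (a + b)) • (y - α.center)‖ < α.radius := by
    refine norm_combo_lt_of_ne hx.le hy.le (by simpa [sub_left_inj] using hxy) (by positivity)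
      (by positivity) (by field_simp)
  have h2 : q - α.center = (a + b) • ((a / (a + b)) • (x - α.center) +
      (b / (a + b)) • (y - α.center)) + c • (z - α.center) := by
    have e1 : (a + b) * (a / (a + b)) = a := by field_simp
    have e2 : (a + b) * (b / (a + b)) = b := by field_simp
    rw [smul_add, smul_smul, smul_smul, e1, e2, hq]
    have : α.center = (a + b + c) • α.center := by rw [habc, one_smul]
    nth_rewrite 1 [this]
    module
  have h3 := norm_add_le ((a + b) • ((a / (a + b)) • (x - α.center) +
      (b / (a + b)) • (y - α.center))) (c • (z - α.center))
  rw [← h2, norm_smul, norm_smul, hqα, hz, Real.norm_of_nonneg (by positivity),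
    Real.norm_of_nonneg hc.le] at h3
  have h4 := mul_lt_mul_of_pos_left h1 (show 0 < a + b by positivity)
  have h5 : (a + b + c) * α.radius = α.radius := by rw [habc, one_mul]
  nlinarith

theorem isClosed_circ (α : Circ) : IsClosed {p | p ∈ α} := by
  simp only [EuclideanGeometry.mem_sphere]
  exact isClosed_eq (by fun_prop) continuous_const

theorem isClosed_biUnion_circ (B : Set Circ) (hB : B.Finite) : IsClosed {p | ∃ α ∈ B, p ∈ α} := by
  have : {p | ∃ α ∈ B, p ∈ α} = ⋃ α ∈ B, {p : Plane | p ∈ α} := by ext; simp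
  rw [this]
  exact hB.isClosed_biUnion fun α _ => isClosed_circ α

theorem isClosed_skeleton (A : Finset Circ) : IsClosed (skeleton A) :=
  isClosed_biUnion_circ A A.finite_toSet

variable {A : Finset Circ} {F G e : Set Plane} {α β γ : Circ} {p q v : Plane}

/-! ### Faces and the local structure of the arrangement. -/

namespace IsFace

theorem isOpen (hF : IsFace A F) : IsOpen F := by
  obtain ⟨x, -, rfl⟩ := hF
  exact (isClosed_skeleton A).isOpen_compl.connectedComponentIn

theorem isPreconnected (hF : IsFace A F) : IsPreconnected F := by
  obtain ⟨x, -, rfl⟩ := hF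
  exact isPreconnected_connectedComponentIn

theorem nonempty (hF : IsFace A F) : F.Nonempty := by
  obtain ⟨x, hx, rfl⟩ := hF
  exact ⟨x, mem_connectedComponentIn hx⟩

theorem notMem_skeleton (hF : IsFace A F) (hp : p ∈ F) : p ∉ skeleton A := by
  obtain ⟨x, hx, rfl⟩ := hF
  exact connectedComponentIn_subset _ _ hp

theorem subset_of_isPreconnected (hF : IsFace A F) {s : Set Plane} (hs : IsPreconnected s)
    (hsA : s ⊆ (skeleton A)ᶜ) (h : (s ∩ F).Nonempty) : s ⊆ F := by
  obtain ⟨x, hx, rfl⟩ := hF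
  obtain ⟨y, hys, hy⟩ := h
  rw [connectedComponentIn_eq hy]
  exact hs.subset_connectedComponentIn hys hsA

theorem eq_of_inter (hF : IsFace A F) (hG : IsFace A G) (h : (F ∩ G).Nonempty) : F = G :=
  (hG.subset_of_isPreconnected hF.isPreconnected (fun _ hx => hF.notMem_skeleton hx) h).antisymm
    (hF.subset_of_isPreconnected hG.isPreconnected (fun _ hx => hG.notMem_skeleton hx)
      (by rwa [inter_comm]))

theorem exists_of_notMem (hp : p ∉ skeleton A) : ∃ F, IsFace A F ∧ p ∈ F :=
  ⟨_, ⟨p, hp, rfl⟩, mem_connectedComponentIn hp⟩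

theorem mem_skeleton_of_mem_frontier (hF : IsFace A F) (hp : p ∈ frontier F) : p ∈ skeleton A := by
  by_contra h
  obtain ⟨G, hG, hpG⟩ := exists_of_notMem h
  rw [hF.isOpen.frontier_eq] at hp
  have := mem_closure_iff.1 hp.1 G hG.isOpen hpG
  exact hp.2 (hG.eq_of_inter hF this ▸ hpG)

theorem mem_frontier (hF : IsFace A F) (hp : p ∈ skeleton A) (hpF : p ∈ closure F) :
    p ∈ frontier F := by
  rw [hF.isOpen.frontier_eq]
  exact ⟨hpF, fun h => hF.notMem_skeleton h hp⟩

/-- A face lies on one side of each circle. -/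
theorem exists_sign (hA : IsOrthogonal A) (hF : IsFace A F) (hα : α ∈ A) :
    ∃ σ : ℝ, (σ = 1 ∨ σ = -1) ∧ ∀ x ∈ F, 0 < σ * power α x := by
  have hne : ∀ x ∈ F, power α x ≠ 0 := fun x hx h =>
    hF.notMem_skeleton hx ⟨α, hα, (power_eq_zero_iff (hA.radius_pos α hα)).1 h⟩
  have hcov : F ⊆ {x | 0 < power α x} ∪ {x | power α x < 0} := fun x hx =>
    (lt_or_gt_of_ne (hne x hx)).symm
  have h1 : IsOpen {x | 0 < power α x} := isOpen_lt continuous_const (continuous_power α)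
  have h2 : IsOpen {x | power α x < 0} := isOpen_lt (continuous_power α) continuous_const
  have hd : Disjoint {x | 0 < power α x} {x | power α x < 0} :=
    disjoint_left.2 fun x hx hx' => lt_asymm (a := (0 : ℝ)) (b := power α x) hx hx'
  rcases hF.isPreconnected.subset_or_subset h1 h2 hd hcov with h | h
  · exact ⟨1, Or.inl rfl, fun x hx => by simpa using h hx⟩
  · exact ⟨-1, Or.inr rfl, fun x hx => by simpa using h hx⟩

end IsFace

theorem mem_closure_of_forall_add_smul {E : Type*} [NormedAddCommGroup E] [NormedSpace ℝ E]
    {C : Set E} {y d : E} (h : ∀ ε : ℝ, 0 < ε → y + ε • d ∈ C) : y ∈ closure C := by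
  have hc : Filter.Tendsto (fun ε : ℝ => y + ε • d) (𝓝[>] 0) (𝓝 y) := by
    have : ContinuousAt (fun ε : ℝ => y + ε • d) 0 := by fun_prop
    simpa using this.tendsto.mono_left nhdsWithin_le_nhds
  exact mem_closure_of_tendsto hc (Filter.eventually_of_mem self_mem_nhdsWithin h)

theorem convex_pos_mul_fst (σ : ℝ) : Convex ℝ {y : ℝ × ℝ | 0 < σ * y.1} :=
  convex_halfSpace_gt (f := fun y : ℝ × ℝ => σ * y.1)
    ⟨fun x y => by simp; ring, fun c x => by simp; ring⟩ 0

theorem convex_pos_mul_snd (σ : ℝ) : Convex ℝ {y : ℝ × ℝ | 0 < σ * y.2} :=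
  convex_halfSpace_gt (f := fun y : ℝ × ℝ => σ * y.2)
    ⟨fun x y => by simp; ring, fun c x => by simp; ring⟩ 0

theorem convex_fst_eq_zero : Convex ℝ {y : ℝ × ℝ | y.1 = 0} :=
  convex_hyperplane (f := fun y : ℝ × ℝ => y.1) ⟨fun x y => by simp, fun c x => by simp⟩ 0

theorem compl_other_mem_nhds (B : Set Circ) (hB : B ⊆ A) (h : ∀ γ ∈ B, p ∉ γ) :
    {x | ∀ γ ∈ B, x ∉ γ} ∈ 𝓝 p := by
  have : {x | ∀ γ ∈ B, x ∉ γ} = {p : Plane | ∃ α ∈ B, p ∈ α}ᶜ := by ext; simp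
  rw [this]
  refine (isClosed_biUnion_circ B (A.finite_toSet.subset hB)).isOpen_compl.mem_nhds ?_
  simpa using h

/-- Local structure of an arrangement at a point of exactly one circle. -/
theorem IsOrthogonal.exists_nhds_of_notMem_vertices (hA : IsOrthogonal A) (hα : α ∈ A) (hp : p ∈ α)
    (hpv : p ∉ vertices A) :
    ∃ U : Set Plane, IsOpen U ∧ p ∈ U ∧ (∀ x ∈ U, ∀ γ ∈ A, x ∈ γ → γ = α) ∧
      ∀ σ : ℝ, (σ = 1 ∨ σ = -1) → IsPreconnected (U ∩ {x | 0 < σ * power α x}) ∧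
        ∀ q ∈ U, q ∈ α → q ∈ closure (U ∩ {x | 0 < σ * power α x}) := by
  have hr := hA.radius_pos α hα
  have hne := ne_center_of_mem hp hr
  -- An auxiliary circle through `p`, orthogonal to `α` there and not required to be in `A`; it only
  -- supplies the second coordinate of the chart.
  let β : Circ := ⟨p - rot (p - α.center), ‖rot (p - α.center)‖⟩
  have hpβ : p - β.center = rot (p - α.center) := sub_sub_cancel _ _
  obtain ⟨U, hU, hpU, hUW, h1, h2⟩ := exists_chart (α := α) (β := β) hne
    (by
      rw [← sub_ne_zero, hpβ, ← norm_ne_zero_iff, norm_rot]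
      exact norm_ne_zero_iff.2 (sub_ne_zero.2 hne))
    (by rw [hpβ]; exact inner_rot_self _) ((power_eq_zero_iff hr).2 hp)
    (by rw [power, hpβ]; exact sub_self _)
    (compl_other_mem_nhds (A := A) (p := p) {γ | γ ∈ A ∧ γ ≠ α} (fun γ h => h.1)
      fun γ h hpγ => hpv ⟨γ, h.1, α, hα, h.2, hpγ, hp⟩)
  refine ⟨U, hU, hpU, fun x hx γ hγ hxγ => ?_, fun σ hσ => ⟨h1 _ (convex_pos_mul_fst σ),
    fun q hq hqα => h2 {y | 0 < σ * y.1} q hq ?_⟩⟩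
  · by_contra h
    exact hUW hx γ ⟨hγ, h⟩ hxγ
  · refine mem_closure_of_forall_add_smul (d := (σ, 0)) fun ε hε => ?_
    rw [(power_eq_zero_iff hr).2 hqα]
    rcases hσ with rfl | rfl <;> simpa

/-- Local structure of an arrangement at a vertex. -/
theorem IsOrthogonal.exists_nhds_of_mem_of_mem (hA : IsOrthogonal A) (hα : α ∈ A) (hβ : β ∈ A)
    (hne : α ≠ β) (hpα : p ∈ α) (hpβ : p ∈ β) :
    ∃ U : Set Plane, IsOpen U ∧ p ∈ U ∧ (∀ x ∈ U, ∀ γ ∈ A, x ∈ γ → γ = α ∨ γ = β) ∧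
      ∀ σ τ : ℝ, (σ = 1 ∨ σ = -1) → (τ = 1 ∨ τ = -1) →
        IsPreconnected (U ∩ {x | 0 < σ * power α x ∧ 0 < τ * power β x}) ∧
        IsPreconnected (U ∩ {x | x ∈ α ∧ 0 < τ * power β x}) ∧
        p ∈ closure (U ∩ {x | x ∈ α ∧ 0 < τ * power β x}) ∧
        ∀ q ∈ U, q ∈ α → 0 < τ * power β q →
          q ∈ closure (U ∩ {x | 0 < σ * power α x ∧ 0 < τ * power β x}) := by
  have hr := hA.radius_pos α hα
  have hr' := hA.radius_pos β hβ
  obtain ⟨U, hU, hpU, hUW, h1, h2⟩ := exists_chart (ne_center_of_mem hpα hr)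
    (ne_center_of_mem hpβ hr') (hA.inner_eq_zero hα hβ hne hpα hpβ)
    ((power_eq_zero_iff hr).2 hpα) ((power_eq_zero_iff hr').2 hpβ)
    (compl_other_mem_nhds (A := A) (p := p) {γ | γ ∈ A ∧ γ ≠ α ∧ γ ≠ β} (fun γ h => h.1)
      fun γ h hpγ => not_or_intro h.2.1 h.2.2 (hA.eq_or_eq_of_mem hα hβ h.1 hne hpα hpβ hpγ))
  have hset : ∀ τ : ℝ, {x | x ∈ α ∧ 0 < τ * power β x} =
      (fun x => (power α x, power β x)) ⁻¹' ({y | y.1 = 0} ∩ {y | 0 < τ * y.2}) := by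
    intro τ; ext x; simp [power_eq_zero_iff hr]
  refine ⟨U, hU, hpU, fun x hx γ hγ hxγ => ?_, fun σ τ hσ hτ =>
    ⟨h1 _ ((convex_pos_mul_fst σ).inter (convex_pos_mul_snd τ)), ?_, ?_, fun q hq hqα hqβ =>
      h2 ({y | 0 < σ * y.1} ∩ {y | 0 < τ * y.2}) q hq ?_⟩⟩
  · by_contra h
    rw [not_or] at h
    exact hUW hx γ ⟨hγ, h⟩ hxγ
  · rw [hset]
    exact h1 _ (convex_fst_eq_zero.inter (convex_pos_mul_snd τ))
  · rw [hset]
    refine h2 _ p hpU (mem_closure_of_forall_add_smul (d := (0, τ)) fun ε hε => ?_)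
    rw [(power_eq_zero_iff hr).2 hpα, (power_eq_zero_iff hr').2 hpβ]
    rcases hτ with rfl | rfl <;> simpa
  · refine mem_closure_of_forall_add_smul (d := (σ, 0)) fun ε hε => ?_
    rw [(power_eq_zero_iff hr).2 hqα]
    rcases hσ with rfl | rfl <;> simpa using ⟨hε, hqβ⟩

/-- The side of `α` within the chart is connected, avoids the skeleton and meets `F`, so it lies in
`F`; the whole arc of `α` in the chart is in its closure. -/
theorem IsFace.exists_nhds_of_mem_frontier (hA : IsOrthogonal A) (hF : IsFace A F) (hα : α ∈ A)
    (hp : p ∈ α) (hpv : p ∉ vertices A) (hpF : p ∈ frontier F) {σ : ℝ} (hσ : σ = 1 ∨ σ = -1)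
    (hs : ∀ x ∈ F, 0 < σ * power α x) :
    ∃ U : Set Plane, IsOpen U ∧ p ∈ U ∧ (∀ x ∈ U, ∀ γ ∈ A, x ∈ γ → γ = α) ∧
      (∀ x ∈ U, x ∈ skeleton A → x ∈ frontier F) ∧ ∀ x ∈ U, 0 < σ * power α x → x ∈ F := by
  obtain ⟨U, hU, hpU, h1, h2⟩ := hA.exists_nhds_of_notMem_vertices hα hp hpv
  obtain ⟨h3, h4⟩ := h2 σ hσ
  have hsub : U ∩ {x | 0 < σ * power α x} ⊆ F := by
    refine hF.subset_of_isPreconnected h3 ?_ ?_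
    · rintro x ⟨hx, hx'⟩ ⟨γ, hγ, hxγ⟩
      obtain rfl := h1 x hx γ hγ hxγ
      have := (power_eq_zero_iff (hA.radius_pos _ hα)).2 hxγ
      simp [this] at hx'
    · obtain ⟨x, hxU, hxF⟩ := mem_closure_iff.1 (frontier_subset_closure hpF) U hU hpU
      exact ⟨x, ⟨hxU, hs x hxF⟩, hxF⟩
  refine ⟨U, hU, hpU, h1, fun x hx hxs => ?_, fun x hx hx' => hsub ⟨hx, hx'⟩⟩
  obtain ⟨γ, hγ, hxγ⟩ := hxs
  obtain rfl := h1 x hx γ hγ hxγ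
  exact hF.mem_frontier ⟨γ, hγ, hxγ⟩ (closure_mono hsub (h4 x hx hxγ))

/-- Along an edge, the faces at its two sides do not change. -/
theorem IsFace.eventually_mem_frontier (hA : IsOrthogonal A) (hF : IsFace A F)
    (hpv : p ∉ vertices A) (hpF : p ∈ frontier F) :
    ∀ᶠ x in 𝓝 p, x ∉ vertices A ∧ (x ∈ skeleton A → x ∈ frontier F) := by
  obtain ⟨α, hα, hp⟩ := hF.mem_skeleton_of_mem_frontier hpF
  obtain ⟨σ, hσ, hs⟩ := hF.exists_sign hA hα
  obtain ⟨U, hU, hpU, -, h, -⟩ := hF.exists_nhds_of_mem_frontier hA hα hp hpv hpF hσ hs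
  filter_upwards [hU.mem_nhds hpU,
    (finite_vertices A).isClosed.isOpen_compl.mem_nhds hpv] with x hx hx'
  exact ⟨hx', h x hx⟩

/-- Two faces on the same side of an edge are equal. -/
theorem IsFace.eq_of_mem_frontier (hA : IsOrthogonal A) (hF : IsFace A F) (hG : IsFace A G)
    (hα : α ∈ A) (hp : p ∈ α) (hpv : p ∉ vertices A) (hpF : p ∈ frontier F) (hpG : p ∈ frontier G)
    {σ : ℝ} (hσ : σ = 1 ∨ σ = -1) (hFs : ∀ x ∈ F, 0 < σ * power α x)
    (hGs : ∀ x ∈ G, 0 < σ * power α x) : F = G := by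
  obtain ⟨U, hU, hpU, -, -, h⟩ := hF.exists_nhds_of_mem_frontier hA hα hp hpv hpF hσ hFs
  obtain ⟨x, hxU, hxG⟩ := mem_closure_iff.1 (frontier_subset_closure hpG) U hU hpU
  exact hF.eq_of_inter hG ⟨x, h x hxU (hGs x hxG), hxG⟩

/-- At either side of an edge there is a face. -/
theorem IsOrthogonal.exists_face (hA : IsOrthogonal A) (hα : α ∈ A) (hp : p ∈ α)
    (hpv : p ∉ vertices A) {σ : ℝ} (hσ : σ = 1 ∨ σ = -1) :
    ∃ F, IsFace A F ∧ p ∈ frontier F ∧ ∀ x ∈ F, 0 < σ * power α x := by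
  obtain ⟨U, hU, hpU, h1, h2⟩ := hA.exists_nhds_of_notMem_vertices hα hp hpv
  obtain ⟨h3, h4⟩ := h2 σ hσ
  have hd : U ∩ {x | 0 < σ * power α x} ⊆ (skeleton A)ᶜ := by
    rintro x ⟨hx, hx'⟩ ⟨γ, hγ, hxγ⟩
    obtain rfl := h1 x hx γ hγ hxγ
    have := (power_eq_zero_iff (hA.radius_pos _ hα)).2 hxγ
    simp [this] at hx'
  obtain ⟨x, hx⟩ := closure_nonempty_iff.1 ⟨p, h4 p hpU hp⟩
  obtain ⟨F, hF, hxF⟩ := IsFace.exists_of_notMem (hd hx)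
  have hsub := hF.subset_of_isPreconnected h3 hd ⟨x, hx, hxF⟩
  refine ⟨F, hF, hF.mem_frontier ⟨α, hα, hp⟩ (closure_mono hsub (h4 p hpU hp)), ?_⟩
  obtain ⟨τ, hτ, hs⟩ := hF.exists_sign hA hα
  have hx1 : 0 < σ * power α x := hx.2
  have hx2 := hs x hxF
  have : τ = σ := by
    rcases hσ with rfl | rfl <;> rcases hτ with rfl | rfl <;> first | rfl | (exfalso; linarith)
  rwa [← this]

/-! ### Edges and the corners of faces. -/

namespace IsEdge

theorem isPreconnected (he : IsEdge A e) : IsPreconnected e := by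
  obtain ⟨x, -, rfl⟩ := he
  exact isPreconnected_connectedComponentIn

theorem nonempty (he : IsEdge A e) : e.Nonempty := by
  obtain ⟨x, hx, rfl⟩ := he
  exact ⟨x, mem_connectedComponentIn hx⟩

theorem subset (he : IsEdge A e) : e ⊆ skeleton A \ vertices A := by
  obtain ⟨x, hx, rfl⟩ := he
  exact connectedComponentIn_subset _ _

theorem exists_of_mem (hp : p ∈ skeleton A) (hpv : p ∉ vertices A) : ∃ e, IsEdge A e ∧ p ∈ e :=
  ⟨_, ⟨p, ⟨hp, hpv⟩, rfl⟩, mem_connectedComponentIn ⟨hp, hpv⟩⟩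

theorem subset_of_isPreconnected (he : IsEdge A e) {s : Set Plane} (hs : IsPreconnected s)
    (hsA : s ⊆ skeleton A \ vertices A) (h : (s ∩ e).Nonempty) : s ⊆ e := by
  obtain ⟨x, hx, rfl⟩ := he
  obtain ⟨y, hys, hy⟩ := h
  rw [connectedComponentIn_eq hy]
  exact hs.subset_connectedComponentIn hys hsA

theorem eq_of_inter {e' : Set Plane} (he : IsEdge A e) (he' : IsEdge A e') (h : (e ∩ e').Nonempty) :
    e = e' :=
  (he'.subset_of_isPreconnected he.isPreconnected he.subset h).antisymm
    (he.subset_of_isPreconnected he'.isPreconnected he'.subset (by rwa [inter_comm]))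

/-- An edge lies on any circle that it meets. -/
theorem mem_circ_of_mem (he : IsEdge A e) (hα : α ∈ A) (hp : p ∈ e) (hpα : p ∈ α) :
    ∀ q ∈ e, q ∈ α := by
  -- Away from the vertices, `α` and the union of the other circles are disjoint closed sets
  -- covering the edge.
  have h := isPreconnected_iff_subset_of_disjoint_closed.1 he.isPreconnected
    {x | x ∈ α} {x | ∃ γ ∈ {γ | γ ∈ A ∧ γ ≠ α}, x ∈ γ} (isClosed_circ α)
    (isClosed_biUnion_circ _ (A.finite_toSet.subset fun γ h => h.1))
    (fun x hx => by
      obtain ⟨γ, hγ, hxγ⟩ := (he.subset hx).1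
      by_cases h : γ = α
      · exact Or.inl (h ▸ hxγ)
      · exact Or.inr ⟨γ, ⟨hγ, h⟩, hxγ⟩)
    (by
      rw [eq_empty_iff_forall_notMem]
      rintro x ⟨hx, hxα, γ, ⟨hγ, hne⟩, hxγ⟩
      exact (he.subset hx).2 ⟨γ, hγ, α, hα, hne, hxγ, hxα⟩)
  rcases h with h | h
  · exact fun q hq => h hq
  · obtain ⟨γ, ⟨hγ, hne⟩, hpγ⟩ := h hp
    exact absurd ⟨γ, hγ, α, hα, hne, hpγ, hpα⟩ (he.subset hp).2

/-- An edge that meets the boundary of a face is contained in it. -/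
theorem subset_frontier (hA : IsOrthogonal A) (he : IsEdge A e) (hF : IsFace A F) (hp : p ∈ e)
    (hpF : p ∈ frontier F) : e ⊆ frontier F := by
  intro q hq
  by_contra hqF
  -- The frontier of `F` is closed, and relatively open in the edge.
  obtain ⟨x, hx, hx1, hx2⟩ := he.isPreconnected
    (interior {x | x ∈ skeleton A → x ∈ frontier F}) (frontier F)ᶜ
    isOpen_interior isClosed_frontier.isOpen_compl
    (fun x hx => by
      by_cases hxF : x ∈ frontier F
      · left
        rw [mem_interior_iff_mem_nhds]
        exact (hF.eventually_mem_frontier hA (he.subset hx).2 hxF).mono fun _ h => h.2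
      · exact Or.inr hxF)
    ⟨p, hp, mem_interior_iff_mem_nhds.2
      ((hF.eventually_mem_frontier hA (he.subset hp).2 hpF).mono fun _ h => h.2)⟩ ⟨q, hq, hqF⟩
  exact hx2 (interior_subset hx1 (he.subset hx).1)

end IsEdge

/-- Near a vertex on its boundary, a face is a quadrant. -/
theorem IsFace.quadrant_subset (hA : IsOrthogonal A) (hF : IsFace A F) (hα : α ∈ A) (hβ : β ∈ A)
    {U : Set Plane} (hU : IsOpen U) (hpU : p ∈ U) (h1 : ∀ x ∈ U, ∀ γ ∈ A, x ∈ γ → γ = α ∨ γ = β)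
    {σ τ : ℝ} (h3 : IsPreconnected (U ∩ {x | 0 < σ * power α x ∧ 0 < τ * power β x}))
    (hpF : p ∈ frontier F) (hs : ∀ x ∈ F, 0 < σ * power α x) (ht : ∀ x ∈ F, 0 < τ * power β x) :
    U ∩ {x | 0 < σ * power α x ∧ 0 < τ * power β x} ⊆ F := by
  refine hF.subset_of_isPreconnected h3 ?_ ?_
  · rintro x ⟨hx, hx1, hx2⟩ ⟨γ, hγ, hxγ⟩
    have h0 := (power_eq_zero_iff (hA.radius_pos _ hγ)).2 hxγ
    rcases h1 x hx γ hγ hxγ with rfl | rfl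
    · simp [h0] at hx1
    · simp [h0] at hx2
  · obtain ⟨x, hxU, hxF⟩ := mem_closure_iff.1 (frontier_subset_closure hpF) U hU hpU
    exact ⟨x, ⟨hxU, hs x hxF, ht x hxF⟩, hxF⟩

/-- At a vertex on the boundary of a face, each of the two circles contains a bounding edge of the
face that ends at the vertex. -/
theorem IsFace.exists_edge_of_mem_of_mem (hA : IsOrthogonal A) (hF : IsFace A F) (hα : α ∈ A)
    (hβ : β ∈ A) (hne : α ≠ β) (hpα : p ∈ α) (hpβ : p ∈ β) (hpF : p ∈ frontier F) :
    ∃ e ∈ boundingEdges A F, p ∈ closure e ∧ ∀ x ∈ e, x ∈ α := by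
  obtain ⟨U, hU, hpU, h1, h2⟩ := hA.exists_nhds_of_mem_of_mem hα hβ hne hpα hpβ
  obtain ⟨σ, hσ, hs⟩ := hF.exists_sign hA hα
  obtain ⟨τ, hτ, ht⟩ := hF.exists_sign hA hβ
  obtain ⟨h3, h4, h5, h6⟩ := h2 σ τ hσ hτ
  have hsub := hF.quadrant_subset hA hα hβ hU hpU h1 h3 hpF hs ht
  have harc : U ∩ {x | x ∈ α ∧ 0 < τ * power β x} ⊆ skeleton A \ vertices A := by
    rintro x ⟨hxU, hxα, hxβ⟩
    have hxβ' : x ∉ β := fun h => by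
      rw [(power_eq_zero_iff (hA.radius_pos _ hβ)).2 h] at hxβ
      simp at hxβ
    refine ⟨⟨α, hα, hxα⟩, ?_⟩
    rintro ⟨γ, hγ, δ, hδ, hγδ, hxγ, hxδ⟩
    have e1 := h1 x hxU γ hγ hxγ
    have e2 := h1 x hxU δ hδ hxδ
    rcases e1 with rfl | rfl
    · rcases e2 with rfl | rfl
      · exact hγδ rfl
      · exact hxβ' hxδ
    · exact hxβ' hxγ
  obtain ⟨q, hq⟩ := closure_nonempty_iff.1 ⟨p, h5⟩
  obtain ⟨e, he, hqe⟩ := IsEdge.exists_of_mem (harc hq).1 (harc hq).2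
  have hqF : q ∈ frontier F :=
    hF.mem_frontier (harc hq).1 (closure_mono hsub (h6 q hq.1 hq.2.1 hq.2.2))
  exact ⟨e, ⟨he, he.subset_frontier hA hF hqe hqF⟩,
    closure_mono (he.subset_of_isPreconnected h4 harc ⟨q, hq, hqe⟩) h5,
    he.mem_circ_of_mem hα hqe hq.2.1⟩

/-! ### Comparing the numbers of vertices and edges of a face. -/

/-- Twice the signed area of a triangle. -/
noncomputable def cross (x y z : Plane) : ℝ := (y 0 - x 0) * (z 1 - x 1) - (y 1 - x 1) * (z 0 - x 0)

theorem mem_circ_iff_coord (hr : 0 < α.radius) {x : Plane} :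
    x ∈ α ↔ (x 0 - α.center 0) ^ 2 + (x 1 - α.center 1) ^ 2 = α.radius ^ 2 := by
  rw [← power_eq_zero_iff hr, power, ← real_inner_self_eq_norm_sq, inner_eq_coord, sub_eq_zero]
  simp only [PiLp.sub_apply, sq]

theorem cross_ne_zero (hr : 0 < α.radius) {x y z : Plane} (hx : x ∈ α) (hy : y ∈ α) (hz : z ∈ α)
    (hxy : x ≠ y) (hxz : x ≠ z) (hyz : y ≠ z) : cross x y z ≠ 0 := by
  intro h
  rw [cross] at h
  rw [mem_circ_iff_coord hr] at hx hy hz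
  have hne : ∀ {a b : Plane}, a ≠ b → 0 < (b 0 - a 0) ^ 2 + (b 1 - a 1) ^ 2 := by
    intro a b hab
    by_contra hc
    have e0 : (b 0 - a 0) ^ 2 = 0 :=
      le_antisymm (by nlinarith [sq_nonneg (b 1 - a 1)]) (sq_nonneg _)
    have e1 : (b 1 - a 1) ^ 2 = 0 :=
      le_antisymm (by nlinarith [sq_nonneg (b 0 - a 0)]) (sq_nonneg _)
    refine hab (PiLp.ext fun i => ?_)
    fin_cases i
    · exact (sub_eq_zero.1 (pow_eq_zero_iff two_ne_zero |>.1 e0)).symm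
    · exact (sub_eq_zero.1 (pow_eq_zero_iff two_ne_zero |>.1 e1)).symm
  have h1 := hne hxy
  have h2 := hne hxz
  have h3 := hne hyz
  set d0 := y 0 - x 0 with hd0
  set d1 := y 1 - x 1 with hd1
  set f0 := z 0 - x 0 with hf0
  set f1 := z 1 - x 1 with hf1
  set X0 := x 0 - α.center 0
  set X1 := x 1 - α.center 1
  have e1 : d0 ^ 2 + d1 ^ 2 = -2 * (X0 * d0 + X1 * d1) := by
    simp only [d0, d1, X0, X1]; linear_combination hy - hx
  have e2 : f0 ^ 2 + f1 ^ 2 = -2 * (X0 * f0 + X1 * f1) := by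
    simp only [f0, f1, X0, X1]; linear_combination hz - hx
  -- For parallel chords `d`, `f` from `x`, the circle equations force `d · f = ‖f‖² = ‖d‖²`, hence
  -- `d = f` and `y = z`.
  have e3 : (d0 ^ 2 + d1 ^ 2) * (d0 * f0 + d1 * f1) = (f0 ^ 2 + f1 ^ 2) * (d0 ^ 2 + d1 ^ 2) := by
    linear_combination (d0 * f0 + d1 * f1) * e1 - (d0 ^ 2 + d1 ^ 2) * e2 -
      2 * (X0 * d1 - X1 * d0) * h
  have e4 : (f0 ^ 2 + f1 ^ 2) * (d0 * f0 + d1 * f1) = (d0 ^ 2 + d1 ^ 2) * (f0 ^ 2 + f1 ^ 2) := by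
    linear_combination (d0 * f0 + d1 * f1) * e2 - (f0 ^ 2 + f1 ^ 2) * e1 +
      2 * (X0 * f1 - X1 * f0) * h
  have e5 := mul_left_cancel₀ h1.ne' (e3.trans (mul_comm _ _))
  have e6 := mul_left_cancel₀ h2.ne' (e4.trans (mul_comm _ _))
  have e7 : (z 0 - y 0) ^ 2 + (z 1 - y 1) ^ 2 = 0 := by
    have g0 : z 0 - y 0 = f0 - d0 := by simp [f0, d0]
    have g1 : z 1 - y 1 = f1 - d1 := by simp [f1, d1]
    rw [g0, g1]
    linear_combination -e5 - e6
  exact h3.ne' e7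

theorem continuous_cross (x y : Plane) : Continuous (cross x y) := by
  unfold cross; fun_prop

/-- A continuous function without zeros keeps its sign on a connected set, and a nonzero limit value
inherits that sign. -/
theorem _root_.IsPreconnected.mul_pos_of_mem_closure {X : Type*} [TopologicalSpace X] {s : Set X}
    (hs : IsPreconnected s) {g : X → ℝ} (hg : Continuous g) (h0 : ∀ x ∈ s, g x ≠ 0) {w : X}
    (hw : w ∈ closure s) (hgw : g w ≠ 0) {x : X} (hx : x ∈ s) : 0 < g x * g w := by
  by_contra hc
  have hc' : g x * g w < 0 := lt_of_le_of_ne (not_lt.1 hc) (mul_ne_zero (h0 x hx) hgw)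
  have hopen : IsOpen {y | 0 < g y * g w} := isOpen_lt continuous_const (by fun_prop)
  obtain ⟨y, hy, hys⟩ := mem_closure_iff.1 hw _ hopen (mul_self_pos.2 hgw)
  obtain ⟨z, hz, hz0⟩ := hs.intermediate_value hx hys
    (f := fun y => g y * g w) (by fun_prop) (show (0 : ℝ) ∈ _ from ⟨hc'.le, le_of_lt hy⟩)
  exact mul_ne_zero (h0 z hz) hgw hz0

/-- An edge has at most two end points. -/
theorem IsEdge.not_three_ends (he : IsEdge A e) (hr : 0 < α.radius) (heα : ∀ x ∈ e, x ∈ α)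
    {x y z : Plane} (hx : x ∈ vertices A) (hy : y ∈ vertices A) (hz : z ∈ vertices A)
    (hxe : x ∈ closure e) (hye : y ∈ closure e) (hze : z ∈ closure e)
    (hxy : x ≠ y) (hxz : x ≠ z) (hyz : y ≠ z) : False := by
  have hcl : closure e ⊆ {p | p ∈ α} := closure_minimal heα (isClosed_circ α)
  have hxα : x ∈ α := hcl hxe
  have hyα : y ∈ α := hcl hye
  have hzα : z ∈ α := hcl hze
  have hne : ∀ {q w}, q ∈ e → w ∈ vertices A → w ≠ q :=
    fun hq hw h => (he.subset hq).2 (h ▸ hw)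
  -- The edge avoids the ends `a` and `b`, so it stays on one side of the chord `ab`, the side of
  -- its third end `c`. Applied to all three chords, this makes the barycentric coordinates of `q`
  -- positive: `q` is interior to a triangle inscribed in the circle on which it lies.
  have hsign : ∀ {a b c : Plane}, a ∈ vertices A → b ∈ vertices A → a ∈ α → b ∈ α → c ∈ α →
      c ∈ closure e → a ≠ b → a ≠ c → b ≠ c → ∀ q ∈ e, 0 < cross a b q * cross a b c :=
    fun ha hb haα hbα hcα hce hab hac hbc q hq =>
      he.isPreconnected.mul_pos_of_mem_closure (continuous_cross _ _)
        (fun q hq => cross_ne_zero hr haα hbα (heα q hq) hab (hne hq ha) (hne hq hb)) hce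
        (cross_ne_zero hr haα hbα hcα hab hac hbc) hq
  obtain ⟨q, hq⟩ := he.nonempty
  have h1 := hsign hx hy hxα hyα hzα hze hxy hxz hyz q hq
  have h2 := hsign hy hz hyα hzα hxα hxe hyz hxy.symm hxz.symm q hq
  have h3 := hsign hz hx hzα hxα hyα hye hxz.symm hyz.symm hxy q hq
  have hD := cross_ne_zero hr hxα hyα hzα hxy hxz hyz
  have c2 : cross y z x = cross x y z := by unfold cross; ring
  have c3 : cross z x y = cross x y z := by unfold cross; ring
  rw [c2] at h2
  rw [c3] at h3
  have hpos : ∀ {a : ℝ}, 0 < a * cross x y z → 0 < a / cross x y z := fun {a} h => by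
    rw [div_eq_mul_inv]
    have : a * (cross x y z)⁻¹ = a * cross x y z / (cross x y z) ^ 2 := by field_simp
    rw [this]
    positivity
  refine not_mem_of_interior_triangle hxα hyα hzα hxy (hpos h2) (hpos h3) (hpos h1) ?_ ?_ (heα q hq)
  · field_simp
    unfold cross; ring
  · ext i
    simp only [PiLp.add_apply, PiLp.smul_apply, smul_eq_mul]
    field_simp
    fin_cases i <;> simp [cross] <;> ring

/-- A face has at most as many vertices as edges. -/
theorem IsFace.ncard_vertices_le (hA : IsOrthogonal A) (hF : IsFace A F) {k : ℕ}
    (hk : (boundingEdges A F).encard = k) : (vertices A ∩ frontier F).ncard ≤ k := by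
  classical
  have hE : (boundingEdges A F).Finite := finite_of_encard_eq_coe hk
  have hV : (vertices A ∩ frontier F).Finite := (finite_vertices A).inter_of_left _
  -- Double counting of incidences: each vertex ends at least two bounding edges, one on each
  -- circle, and each edge has at most two ends.
  have key := Finset.card_mul_le_card_mul (s := hV.toFinset) (t := hE.toFinset) (m := 2) (n := 2)
    (fun p e => p ∈ closure e) ?_ ?_
  · rw [ncard_eq_toFinset_card _ hV]
    rw [hE.encard_eq_coe_toFinset_card] at hk
    have : hE.toFinset.card = k := by exact_mod_cast hk
    omega
  · intro p hp
    obtain ⟨⟨α, hα, β, hβ, hne, hpα, hpβ⟩, hpF⟩ := hV.mem_toFinset.1 hp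
    obtain ⟨e, he, hpe, heα⟩ := hF.exists_edge_of_mem_of_mem hA hα hβ hne hpα hpβ hpF
    obtain ⟨e', he', hpe', heβ⟩ := hF.exists_edge_of_mem_of_mem hA hβ hα hne.symm hpβ hpα hpF
    have hee : e ≠ e' := by
      rintro rfl
      obtain ⟨q, hq⟩ := he.1.nonempty
      exact (he.1.subset hq).2 ⟨α, hα, β, hβ, hne, heα q hq, heβ q hq⟩
    refine (Finset.card_pair hee).symm.le.trans (Finset.card_le_card fun f hf => ?_)
    rw [Finset.mem_bipartiteAbove]
    rcases Finset.mem_insert.1 hf with rfl | hf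
    · exact ⟨hE.mem_toFinset.2 he, hpe⟩
    · obtain rfl := Finset.mem_singleton.1 hf
      exact ⟨hE.mem_toFinset.2 he', hpe'⟩
  · intro e he
    by_contra! hc
    obtain ⟨x, hx, y, hy, z, hz, hxy, hxz, hyz⟩ := Finset.two_lt_card.1 hc
    simp only [Finset.mem_bipartiteBelow, hV.mem_toFinset] at hx hy hz
    have he' := (hE.mem_toFinset.1 he).1
    obtain ⟨q, hq⟩ := he'.nonempty
    obtain ⟨α, hα, hqα⟩ := (he'.subset hq).1
    exact he'.not_three_ends (hA.radius_pos α hα) (he'.mem_circ_of_mem hα hq hqα)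
      hx.1.1 hy.1.1 hz.1.1 hx.2 hy.2 hz.2 hxy hxz hyz

/-! ### Directions, points of circles and normal cones. -/

/-- The unit vector with argument `t`. -/
noncomputable def dir (t : ℝ) : Plane := !₂[cos t, sin t]

theorem inner_dir (t : ℝ) (x : Plane) : ⟪dir t, x⟫ = cos t * x 0 + sin t * x 1 := by
  rw [inner_eq_coord]; simp [dir]

theorem inner_dir_dir (s t : ℝ) : ⟪dir s, dir t⟫ = cos (s - t) := by
  rw [inner_dir, cos_sub]; simp [dir]

theorem norm_dir (t : ℝ) : ‖dir t‖ = 1 := by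
  rw [← sq_eq_sq₀ (norm_nonneg _) zero_le_one, ← real_inner_self_eq_norm_sq, inner_dir_dir]
  simp

theorem continuous_dir : Continuous dir := by
  unfold dir
  refine (PiLp.continuous_toLp 2 _).comp (continuous_pi fun i => ?_)
  fin_cases i
  · exact continuous_cos
  · exact continuous_sin

theorem exists_eq_norm_smul_dir (x : Plane) : ∃ s ∈ Ioc (-π) π, x = ‖x‖ • dir s := by
  let z : ℂ := ⟨x 0, x 1⟩
  have hz : ‖z‖ = ‖x‖ := by
    rw [← sq_eq_sq₀ (norm_nonneg _) (norm_nonneg _), Complex.sq_norm, Complex.normSq_apply,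
      ← real_inner_self_eq_norm_sq, inner_eq_coord]
  refine ⟨z.arg, Complex.arg_mem_Ioc z, ?_⟩
  ext i
  fin_cases i
  · simpa [dir, hz, z] using (Complex.norm_mul_cos_arg z).symm
  · simpa [dir, hz, z] using (Complex.norm_mul_sin_arg z).symm

/-- The point of a circle in direction `t` from the center. -/
noncomputable def pt (α : Circ) (t : ℝ) : Plane := α.center + α.radius • dir t

theorem continuous_pt (α : Circ) : Continuous (pt α) := by
  have := continuous_dir
  unfold pt
  fun_prop

theorem pt_mem (hr : 0 < α.radius) (t : ℝ) : pt α t ∈ α := by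
  rw [EuclideanGeometry.mem_sphere, dist_eq_norm, pt, add_sub_cancel_left, norm_smul, norm_dir,
    Real.norm_of_nonneg hr.le, mul_one]

theorem exists_eq_pt (hp : p ∈ α) : ∃ s ∈ Ioc (-π) π, p = pt α s := by
  obtain ⟨s, hs, h⟩ := exists_eq_norm_smul_dir (p - α.center)
  refine ⟨s, hs, ?_⟩
  rw [← dist_eq_norm, EuclideanGeometry.mem_sphere.1 hp] at h
  rw [pt, ← h, add_sub_cancel]

/-- The only local maximum of a linear function on a circle is the obvious one. -/
theorem eq_pt_of_eventually_le (hr : 0 < α.radius) (hp : p ∈ α) {t : ℝ}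
    (h : ∀ᶠ x in 𝓝 p, x ∈ α → ⟪dir t, x⟫ ≤ ⟪dir t, p⟫) : p = pt α t := by
  obtain ⟨s, -, rfl⟩ := exists_eq_pt hp
  have hval : ∀ y, ⟪dir t, pt α y⟫ = ⟪dir t, α.center⟫ + α.radius * cos (t - y) := fun y => by
    rw [pt, inner_add_right, inner_smul_right, inner_dir_dir]
  have h1 : ∀ᶠ y in 𝓝 s, cos (t - y) ≤ cos (t - s) := by
    filter_upwards [(continuous_pt α).continuousAt.eventually h] with y hy
    have := hy (pt_mem hr y)
    rw [hval, hval] at this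
    exact le_of_mul_le_mul_left (by linarith) hr
  have h2 : sin (t - s) = 0 := by
    have hd : HasDerivAt (fun y => cos (t - y)) (-sin (t - s) * (-1)) s :=
      (Real.hasDerivAt_cos _).comp s ((hasDerivAt_id s).const_sub t)
    simpa using IsLocalMax.hasDerivAt_eq_zero h1 hd
  have h3 : cos (t - s) = 1 := by
    have h4 : cos (t - s) ^ 2 = 1 := by
      have := sin_sq_add_cos_sq (t - s)
      rw [h2] at this; linarith
    rcases mul_self_eq_one_iff.1 ((sq _).symm.trans h4) with h5 | h5
    · exact h5
    -- The antipode is a strict minimum, refuted by a small rotation; the cap `1` keeps the angle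
    -- below `π`, where the cosine is strictly decreasing.
    · exfalso
      obtain ⟨δ, hδ, hb⟩ := Metric.eventually_nhds_iff.1 h1
      have h6 := hb (y := s + min (δ / 2) 1) (by
        rw [Real.dist_eq, add_sub_cancel_left, abs_of_pos (by positivity)]
        exact (min_le_left _ _).trans_lt (by linarith))
      have h7 : 0 < min (δ / 2) 1 := by positivity
      have h8 : min (δ / 2) 1 ≤ 1 := min_le_right _ _
      rw [show t - (s + min (δ / 2) 1) = (t - s) - min (δ / 2) 1 by ring, cos_sub, h5, h2] at h6
      have h9 : cos (min (δ / 2) 1) < 1 := by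
        have := Real.cos_lt_cos_of_nonneg_of_le_pi (le_refl 0)
          (h8.trans (by linarith [Real.pi_gt_three])) h7
        simpa using this
      linarith
  have hdir : dir s = dir t := by
    have e1 : cos s = cos t := by
      have := cos_sub t (t - s); rw [h2, h3] at this; simpa using this
    have e2 : sin s = sin t := by
      have := sin_sub t (t - s); rw [h2, h3] at this; simpa using this
    rw [dir, dir, e1, e2]
  rw [pt, pt, hdir]

/-- All half-open periods are fundamental domains for translation by `2π`. This lets a normal cone
be measured from an angle at which it does not wrap around. -/
theorem volume_inter_Ioc_eq {P : Set ℝ} (hP : MeasurableSet P)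
    (hper : ∀ t, t + 2 * π ∈ P ↔ t ∈ P) (a b : ℝ) :
    volume (P ∩ Ioc a (a + 2 * π)) = volume (P ∩ Ioc b (b + 2 * π)) := by
  refine (isAddFundamentalDomain_Ioc two_pi_pos a).measure_set_eq
    (isAddFundamentalDomain_Ioc two_pi_pos b) hP ?_
  rintro ⟨g, hg⟩
  obtain ⟨n, rfl⟩ := AddSubgroup.mem_zmultiples_iff.1 hg
  ext t
  have hp : Function.Periodic (fun t => t ∈ P) (2 * π) := fun t => propext (hper t)
  have := hp.zsmul n t
  simp only [mem_preimage]
  rw [show (⟨n • (2 * π), hg⟩ : AddSubgroup.zmultiples (2 * π)) +ᵥ t = t + n • (2 * π) from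
    add_comm _ _]
  exact this.to_iff

/-- The normal cone at a right-angled corner spans a right angle. -/
theorem volume_normal_cone_le {a b : Plane} (ha : a ≠ 0) (hb : b ≠ 0) (hab : ⟪a, b⟫ = 0) :
    volume {t ∈ Ioc (-π) π | ⟪dir t, a⟫ ≤ 0 ∧ ⟪dir t, b⟫ ≤ 0} ≤ ENNReal.ofReal (π / 2) := by
  obtain ⟨s, -, has⟩ := exists_eq_norm_smul_dir a
  have hna : 0 < ‖a‖ := norm_pos_iff.2 ha
  have hbs : cos s * b 0 + sin s * b 1 = 0 := by
    rw [has, inner_smul_left, inner_dir] at hab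
    simpa [hna.ne'] using hab
  -- Being orthogonal to `dir s`, the vector `b` is a multiple of its rotation; the sign of `l`
  -- decides which quadrant the cone is.
  obtain ⟨l, hl0, hl1⟩ : ∃ l : ℝ, b 0 = -l * sin s ∧ b 1 = l * cos s := by
    refine ⟨cos s * b 1 - sin s * b 0, ?_, ?_⟩
    · linear_combination cos s * hbs - b 0 * sin_sq_add_cos_sq s
    · linear_combination sin s * hbs - b 1 * sin_sq_add_cos_sq s
  have hl : l ≠ 0 := by
    rintro rfl
    refine hb (PiLp.ext fun i => ?_)
    fin_cases i
    · simpa using hl0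
    · simpa using hl1
  have h1 : ∀ t, ⟪dir t, a⟫ ≤ 0 ↔ cos (t - s) ≤ 0 := fun t => by
    rw [has, inner_smul_right, inner_dir_dir]
    exact ⟨fun h => nonpos_of_mul_nonpos_right h hna,
      fun h => mul_nonpos_of_nonneg_of_nonpos hna.le h⟩
  have h2 : ∀ t, ⟪dir t, b⟫ = l * sin (t - s) := fun t => by
    rw [inner_dir, hl0, hl1, sin_sub]; ring
  set P : Set ℝ := {t | ⟪dir t, a⟫ ≤ 0 ∧ ⟪dir t, b⟫ ≤ 0} with hP
  have hPm : MeasurableSet P := by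
    have hc : ∀ x : Plane, Continuous fun t => ⟪dir t, x⟫ := fun x =>
      continuous_dir.inner continuous_const
    exact ((isClosed_le (hc a) continuous_const).inter
      (isClosed_le (hc b) continuous_const)).measurableSet
  have hset : {t ∈ Ioc (-π) π | ⟪dir t, a⟫ ≤ 0 ∧ ⟪dir t, b⟫ ≤ 0} = P ∩ Ioc (-π) (-π + 2 * π) := by
    rw [show -π + 2 * π = π by ring, inter_comm]; rfl
  rw [hset, volume_inter_Ioc_eq hPm (fun t => by simp [hP, dir]) (-π) s]
  have hsub : ∃ m, P ∩ Ioc s (s + 2 * π) ⊆ Icc m (m + π / 2) := by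
    rcases lt_or_gt_of_ne hl with hl | hl
    · refine ⟨s + π / 2, fun t ⟨⟨ht1, ht2⟩, ht3, ht4⟩ => ?_⟩
      rw [h1] at ht1
      rw [h2] at ht2
      have hs := nonneg_of_mul_nonpos_right ht2 hl
      constructor
      · by_contra hc
        have := cos_pos_of_mem_Ioo (x := t - s) ⟨by linarith [pi_pos], by linarith⟩
        linarith
      · by_contra hc
        have : sin (t - s - 2 * π) < 0 ∨ t - s = 2 * π := by
          rcases eq_or_lt_of_le ht4 with h | h
          · right; linarith
          · left; exact sin_neg_of_neg_of_neg_pi_lt (by linarith) (by linarith)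
        rcases this with h | h
        · rw [sin_sub_two_pi] at h; linarith
        · rw [h, cos_two_pi] at ht1; linarith
    · refine ⟨s + π, fun t ⟨⟨ht1, ht2⟩, ht3, ht4⟩ => ?_⟩
      rw [h1] at ht1
      rw [h2] at ht2
      have hs := nonpos_of_mul_nonpos_right ht2 hl
      constructor
      · by_contra hc
        have := sin_pos_of_pos_of_lt_pi (x := t - s) (by linarith) (by linarith)
        linarith
      · by_contra hc
        have := cos_pos_of_mem_Ioo (x := t - s - 2 * π) ⟨by linarith, by linarith [pi_pos]⟩
        rw [cos_sub_two_pi] at this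
        linarith
  obtain ⟨m, hm⟩ := hsub
  refine (measure_mono hm).trans_eq ?_
  rw [Real.volume_Icc]; congr 1; ring

theorem volume_real_Ioc_pi : volume.real (Ioc (-π) π) = 2 * π := by
  rw [Real.volume_real_Ioc_of_le (by linarith [pi_pos])]; ring

/-! ### The angle used by a bounded face, and the total budget. -/

/-- The directions in which a face `F` inside the circle `α` has an outer normal along `α`. -/
def normals (A : Finset Circ) (F : Set Plane) (α : Circ) : Set ℝ :=
  {t ∈ Ioc (-π) π | (∀ x ∈ F, power α x < 0) ∧ pt α t ∈ frontier F \ vertices A}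

theorem measurableSet_normals (A : Finset Circ) (F : Set Plane) (α : Circ) :
    MeasurableSet (normals A F α) := by
  refine measurableSet_Ioc.inter ((MeasurableSet.const _).inter ?_)
  exact (continuous_pt α).measurable
    (isClosed_frontier.measurableSet.diff (finite_vertices A).measurableSet)

/-- The directions whose maximum over `F` is attained at a vertex `v` of `F`. -/
theorem IsFace.volume_vertex_le (hA : IsOrthogonal A) (hF : IsFace A F) (hv : v ∈ vertices A)
    (hvF : v ∈ frontier F) :
    volume {t ∈ Ioc (-π) π | ∀ x ∈ F, ⟪dir t, x⟫ ≤ ⟪dir t, v⟫} ≤ ENNReal.ofReal (π / 2) := by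
  obtain ⟨α, hα, β, hβ, hne, hvα, hvβ⟩ := hv
  have hr := hA.radius_pos α hα
  have hr' := hA.radius_pos β hβ
  obtain ⟨U, hU, hvU, h1, h2⟩ := hA.exists_nhds_of_mem_of_mem hα hβ hne hvα hvβ
  obtain ⟨σ, hσ, hs⟩ := hF.exists_sign hA hα
  obtain ⟨τ, hτ, ht⟩ := hF.exists_sign hA hβ
  have hsub := hF.quadrant_subset hA hα hβ hU hvU h1 (h2 σ τ hσ hτ).1 hvF hs ht
  have hab := hA.inner_eq_zero hα hβ hne hvα hvβ
  have hσ2 : σ * σ = 1 := by rcases hσ with rfl | rfl <;> norm_num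
  have hτ2 : τ * τ = 1 := by rcases hτ with rfl | rfl <;> norm_num
  set a := v - α.center with ha
  set b := v - β.center with hb
  have ha0 : a ≠ 0 := sub_ne_zero.2 (ne_center_of_mem hvα hr)
  have hb0 : b ≠ 0 := sub_ne_zero.2 (ne_center_of_mem hvβ hr')
  -- The power vanishes at `v`, so for small `ε > 0` its sign at `v + ε • w` is that of the linear
  -- term.
  have hpow : ∀ (γ : Circ) (ρ : ℝ) (w : Plane), v ∈ γ → 0 < γ.radius →
      0 < ρ * ⟪v - γ.center, w⟫ → ∀ᶠ ε in 𝓝[>] (0 : ℝ), 0 < ρ * power γ (v + ε • w) := by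
    intro γ ρ w hv hγ hw
    have e1 : ∀ ε : ℝ, ρ * power γ (v + ε • w) =
        ε * (2 * (ρ * ⟪v - γ.center, w⟫) + ε * (ρ * ‖w‖ ^ 2)) := by
      intro ε
      have := (power_eq_zero_iff hγ).2 hv
      unfold power at this ⊢
      rw [add_sub_right_comm, norm_add_sq_real, inner_smul_right, norm_smul, mul_pow,
        Real.norm_eq_abs, sq_abs]
      linear_combination ρ * this
    have e2 : ∀ᶠ ε in 𝓝 (0 : ℝ), 0 < 2 * (ρ * ⟪v - γ.center, w⟫) + ε * (ρ * ‖w‖ ^ 2) := by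
      have hc : ContinuousAt (fun ε : ℝ => 2 * (ρ * ⟪v - γ.center, w⟫) + ε * (ρ * ‖w‖ ^ 2)) 0 := by
        fun_prop
      exact hc.tendsto.eventually (lt_mem_nhds (by linarith))
    filter_upwards [e2.filter_mono nhdsWithin_le_nhds, self_mem_nhdsWithin] with ε h1 h2
    rw [e1]
    exact mul_pos h2 h1
  have hcone : ∀ t, (∀ x ∈ F, ⟪dir t, x⟫ ≤ ⟪dir t, v⟫) → ∀ w : Plane, 0 < σ * ⟪a, w⟫ →
      0 < τ * ⟪b, w⟫ → ⟪dir t, w⟫ ≤ 0 := by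
    intro t htF w hwa hwb
    have hUe : ∀ᶠ ε in 𝓝[>] (0 : ℝ), v + ε • w ∈ U := by
      have hc : ContinuousAt (fun ε : ℝ => v + ε • w) 0 := by fun_prop
      exact (hc.eventually (hU.mem_nhds (by simpa using hvU))).filter_mono nhdsWithin_le_nhds
    have hpos : ∀ᶠ ε in 𝓝[>] (0 : ℝ), 0 < ε := self_mem_nhdsWithin
    obtain ⟨ε, hε, h3, h4, h5⟩ := (hpos.and <| hUe.and <|
      (hpow α σ w hvα hr hwa).and (hpow β τ w hvβ hr' hwb)).exists
    have := htF _ (hsub ⟨h3, h4, h5⟩)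
    rw [inner_add_right, inner_smul_right] at this
    exact nonpos_of_mul_nonpos_right (by linarith) hε
  have hlim : ∀ x y : ℝ, (∀ δ > 0, x + δ * y ≤ 0) → x ≤ 0 := by
    intro x y h
    have hc : Filter.Tendsto (fun δ : ℝ => x + δ * y) (𝓝[>] 0) (𝓝 x) := by
      have : ContinuousAt (fun δ : ℝ => x + δ * y) 0 := by fun_prop
      simpa using this.tendsto.mono_left nhdsWithin_le_nhds
    exact le_of_tendsto hc (Filter.eventually_of_mem self_mem_nhdsWithin h)
  have hσ0 : σ ≠ 0 := by rcases hσ with rfl | rfl <;> norm_num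
  have hτ0 : τ ≠ 0 := by rcases hτ with rfl | rfl <;> norm_num
  have haa : 0 < ⟪a, a⟫ := real_inner_self_pos.2 ha0
  have hbb : 0 < ⟪b, b⟫ := real_inner_self_pos.2 hb0
  have hba : ⟪b, a⟫ = 0 := by rwa [real_inner_comm]
  refine (measure_mono ?_).trans (volume_normal_cone_le (a := σ • a) (b := τ • b)
    (smul_ne_zero hσ0 ha0) (smul_ne_zero hτ0 hb0) (by
      rw [inner_smul_left, inner_smul_right, hab]; simp))
  rintro t ⟨htI, htF⟩
  -- The vectors `σ • a` and `τ • b` span the sides of the open quadrant of directions into `F`;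
  -- letting one coefficient tend to `0` reaches the sides themselves.
  have hcomb : ∀ x y : ℝ, 0 < x → 0 < y → ⟪dir t, x • σ • a + y • τ • b⟫ ≤ 0 := by
    intro x y hx hy
    refine hcone t htF _ ?_ ?_
    · simp only [inner_add_right, inner_smul_right, hab]
      have : σ * (x * (σ * ⟪a, a⟫) + y * (τ * 0)) = x * ⟪a, a⟫ := by
        linear_combination x * ⟪a, a⟫ * hσ2
      rw [this]; positivity
    · simp only [inner_add_right, inner_smul_right, hba]
      have : τ * (x * (σ * 0) + y * (τ * ⟪b, b⟫)) = y * ⟪b, b⟫ := by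
        linear_combination y * ⟪b, b⟫ * hτ2
      rw [this]; positivity
  refine ⟨htI, hlim _ ⟪dir t, τ • b⟫ fun δ hδ => ?_, hlim _ ⟪dir t, σ • a⟫ fun δ hδ => ?_⟩
  · have := hcomb 1 δ one_pos hδ
    rwa [one_smul, inner_add_right, inner_smul_right _ (τ • b)] at this
  · have := hcomb δ 1 hδ one_pos
    rwa [one_smul, inner_add_right, inner_smul_right _ (σ • a), add_comm] at this

/-- In every direction, a bounded face has a supporting point, which is a vertex or lies on a
circle around the face. -/
theorem IsFace.exists_normal (hA : IsOrthogonal A) (hF : IsFace A F) (hb : Bornology.IsBounded F)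
    {t : ℝ} (ht : t ∈ Ioc (-π) π) :
    (∃ α ∈ A, t ∈ normals A F α) ∨
      ∃ v ∈ vertices A ∩ frontier F, ∀ x ∈ F, ⟪dir t, x⟫ ≤ ⟪dir t, v⟫ := by
  have hcomp : IsCompact (closure F) := hb.isCompact_closure
  have hcont : Continuous fun x : Plane => ⟪dir t, x⟫ := continuous_const.inner continuous_id
  obtain ⟨p, hp, hmax⟩ := hcomp.exists_isMaxOn hF.nonempty.closure hcont.continuousOn
  have hmax' : ∀ x ∈ closure F, ⟪dir t, x⟫ ≤ ⟪dir t, p⟫ := fun x hx => hmax hx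
  have hout : ∀ ε : ℝ, 0 < ε → p + ε • dir t ∉ F := by
    intro ε hε h
    have := hmax' _ (subset_closure h)
    rw [inner_add_right, inner_smul_right, inner_dir_dir, sub_self, cos_zero] at this
    linarith
  have hlim : Filter.Tendsto (fun ε : ℝ => p + ε • dir t) (𝓝[>] 0) (𝓝 p) := by
    have : ContinuousAt (fun ε : ℝ => p + ε • dir t) 0 := by fun_prop
    simpa using this.tendsto.mono_left nhdsWithin_le_nhds
  have hpF : p ∈ frontier F := by
    rw [hF.isOpen.frontier_eq]
    refine ⟨hp, fun h => ?_⟩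
    obtain ⟨ε, h1, h2⟩ := ((hlim.eventually (hF.isOpen.mem_nhds h)).and
      self_mem_nhdsWithin).exists
    exact hout ε h2 h1
  by_cases hpv : p ∈ vertices A
  · exact Or.inr ⟨p, ⟨hpv, hpF⟩, fun x hx => hmax' x (subset_closure hx)⟩
  left
  obtain ⟨α, hα, hpα⟩ := hF.mem_skeleton_of_mem_frontier hpF
  have hr := hA.radius_pos α hα
  obtain ⟨σ, hσ, hs⟩ := hF.exists_sign hA hα
  obtain ⟨U, hU, hpU, -, h2, h3⟩ := hF.exists_nhds_of_mem_frontier hA hα hpα hpv hpF hσ hs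
  have hpt : p = pt α t := by
    refine eq_pt_of_eventually_le hr hpα ?_
    filter_upwards [hU.mem_nhds hpU] with x hx hxα
    exact hmax' x (frontier_subset_closure (h2 x hx ⟨α, hα, hxα⟩))
  refine ⟨α, hα, ht, ?_, hpt ▸ ⟨hpF, hpv⟩⟩
  -- If `F` were outside `α`, a small step in direction `t` would stay in `F` and go beyond the
  -- extreme point.
  rcases hσ with rfl | rfl
  · exfalso
    obtain ⟨ε, h4, h5⟩ := ((hlim.eventually (hU.mem_nhds hpU)).and self_mem_nhdsWithin).exists
    refine hout ε h5 (h3 _ h4 ?_)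
    have h5' : 0 < ε := h5
    have : p + ε • dir t - α.center = (α.radius + ε) • dir t := by
      rw [hpt, pt]; module
    rw [power, this, norm_smul, norm_dir, Real.norm_of_nonneg (by positivity)]
    nlinarith
  · intro x hx
    have := hs x hx
    linarith

/-- A bounded face with few edges takes up much of the inner sides of the circles around it. -/
theorem IsFace.two_pi_le (hA : IsOrthogonal A) (hF : IsFace A F) (hb : Bornology.IsBounded F)
    {k : ℕ} (hk : (vertices A ∩ frontier F).ncard ≤ k) :
    2 * π - k * (π / 2) ≤ ∑ α ∈ A, volume.real (normals A F α) := by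
  classical
  have hV : (vertices A ∩ frontier F).Finite := (finite_vertices A).inter_of_left _
  have hfin : ∀ s : Set ℝ, s ⊆ Ioc (-π) π → volume s ≠ ⊤ := fun s hs =>
    ((measure_mono hs).trans_lt measure_Ioc_lt_top).ne
  have hcov : Ioc (-π) π ⊆ (⋃ α ∈ A, normals A F α) ∪
      ⋃ v ∈ hV.toFinset, {t ∈ Ioc (-π) π | ∀ x ∈ F, ⟪dir t, x⟫ ≤ ⟪dir t, v⟫} := by
    intro t ht
    rcases hF.exists_normal hA hb ht with ⟨α, hα, h⟩ | ⟨v, hv, h⟩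
    · exact Or.inl (mem_biUnion hα h)
    · exact Or.inr (mem_biUnion (hV.mem_toFinset.2 hv) ⟨ht, h⟩)
  have h1 := volume_real_Ioc_pi
  have h2 : volume.real (⋃ v ∈ hV.toFinset,
      {t ∈ Ioc (-π) π | ∀ x ∈ F, ⟪dir t, x⟫ ≤ ⟪dir t, v⟫}) ≤ k * (π / 2) := by
    refine (measureReal_biUnion_finset_le _ _).trans ?_
    refine (Finset.sum_le_card_nsmul _ _ (π / 2) fun v hv => ?_).trans ?_
    · exact ENNReal.toReal_le_of_le_ofReal (by positivity)
        (hF.volume_vertex_le hA (hV.mem_toFinset.1 hv).1 (hV.mem_toFinset.1 hv).2)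
    · rw [nsmul_eq_mul, ← ncard_eq_toFinset_card _ hV]
      gcongr
  have h3 := measureReal_biUnion_finset_le (μ := volume) A (normals A F)
  have h4 := measureReal_mono (μ := volume) hcov (hfin _ (union_subset
    (iUnion₂_subset fun α _ t ht => ht.1) (iUnion₂_subset fun α _ t ht => ht.1)))
  have h5 := measureReal_union_le (μ := volume) (⋃ α ∈ A, normals A F α)
    (⋃ v ∈ hV.toFinset, {t ∈ Ioc (-π) π | ∀ x ∈ F, ⟪dir t, x⟫ ≤ ⟪dir t, v⟫})
  linarith

/-- The inner sides of the circles have total angle `2π` each. -/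
theorem IsOrthogonal.sum_normals_le (hA : IsOrthogonal A) {𝒟 : Finset (Set Plane)}
    (hD : ∀ F ∈ 𝒟, IsFace A F) :
    ∑ F ∈ 𝒟, ∑ α ∈ A, volume.real (normals A F α) ≤ 2 * π * A.card := by
  rw [Finset.sum_comm, mul_comm, ← nsmul_eq_mul]
  refine Finset.sum_le_card_nsmul _ _ _ fun α hα => ?_
  have hfin : ∀ F ∈ 𝒟, volume (normals A F α) ≠ ⊤ := fun F _ =>
    ((measure_mono fun t ht => ht.1).trans_lt measure_Ioc_lt_top).ne
  rw [← measureReal_biUnion_finset ?_ (fun F _ => measurableSet_normals A F α) hfin]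
  · rw [← volume_real_Ioc_pi]
    exact measureReal_mono (iUnion₂_subset fun F _ t ht => ht.1) measure_Ioc_lt_top.ne
  -- Only one face lies on the inner side of `α` at a given point that is not a vertex.
  · intro F hF G hG hne
    refine disjoint_left.2 fun t ht ht' => hne ?_
    exact (hD F hF).eq_of_mem_frontier hA (hD G hG) hα (pt_mem (hA.radius_pos α hα) t) ht.2.2.2
      ht.2.2.1 ht'.2.2.1 (Or.inr rfl) (fun x hx => by have := ht.2.1 x hx; linarith)
      (fun x hx => by have := ht'.2.1 x hx; linarith)

/-! ### The unbounded face and the angle of its boundary. -/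

theorem isBounded_skeleton (A : Finset Circ) : Bornology.IsBounded (skeleton A) := by
  have : skeleton A = ⋃ α ∈ A, {p : Plane | p ∈ α} := by ext; simp [skeleton]
  rw [this, Bornology.isBounded_biUnion_finset]
  intro α _
  refine (Metric.isBounded_closedBall (x := α.center) (r := α.radius)).subset fun p hp => ?_
  exact (EuclideanGeometry.mem_sphere.1 hp).le

theorem isPreconnected_norm_gt {R : ℝ} (hR : 0 ≤ R) : IsPreconnected {x : Plane | R < ‖x‖} := by
  have : {x : Plane | R < ‖x‖} = (fun y : ℝ × ℝ => y.1 • dir y.2) '' (Ioi R ×ˢ univ) := by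
    ext x
    constructor
    · intro hx
      obtain ⟨s, -, h⟩ := exists_eq_norm_smul_dir x
      exact ⟨(‖x‖, s), ⟨hx, trivial⟩, h.symm⟩
    · rintro ⟨⟨ρ, s⟩, ⟨hρ, -⟩, rfl⟩
      have h : R < ρ := hρ
      simp only [mem_ofPred_eq]
      rwa [norm_smul, norm_dir, mul_one, Real.norm_of_nonneg (hR.trans h.le)]
  rw [this]
  refine (isPreconnected_Ioi.prod isPreconnected_univ).image _ (Continuous.continuousOn ?_)
  have := continuous_dir
  fun_prop

/-- The outside of a disc containing all circles is connected, and every unbounded face meets it. -/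
theorem exists_exterior (A : Finset Circ) :
    ∃ R, ∀ F, IsFace A F → ¬ Bornology.IsBounded F → {x : Plane | R < ‖x‖} ⊆ F := by
  obtain ⟨R, hR0, hR⟩ := (isBounded_skeleton A).exists_pos_norm_le
  refine ⟨R, fun F hF hb => hF.subset_of_isPreconnected (isPreconnected_norm_gt hR0.le)
    (fun x (hx : R < ‖x‖) hxs => (hR x hxs).not_gt hx) ?_⟩
  by_contra h
  refine hb ((Metric.isBounded_closedBall (x := (0 : Plane)) (r := R)).subset fun x hx => ?_)
  rw [mem_closedBall_zero_iff]
  by_contra hc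
  exact h ⟨x, not_le.1 hc, hx⟩

/-- There is at most one unbounded face. -/
theorem IsFace.eq_of_not_isBounded (hF : IsFace A F) (hG : IsFace A G)
    (hFb : ¬ Bornology.IsBounded F) (hGb : ¬ Bornology.IsBounded G) : F = G := by
  obtain ⟨R, hR⟩ := exists_exterior A
  refine hF.eq_of_inter hG ⟨(|R| + 1) • dir 0, hR F hF hFb ?_, hR G hG hGb ?_⟩ <;>
  · have : R < ‖(|R| + 1) • dir 0‖ := by
      rw [norm_smul, norm_dir, mul_one, Real.norm_of_nonneg (by positivity)]
      linarith [le_abs_self R]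
    exact this

/-- In direction `t`, no circle of the arrangement extends further than `α`. -/
def Supports (A : Finset Circ) (α : Circ) (t : ℝ) : Prop :=
  ∀ β ∈ A, ⟪dir t, β.center⟫ + β.radius ≤ ⟪dir t, α.center⟫ + α.radius

theorem inner_dir_pt (α : Circ) (t : ℝ) :
    ⟪dir t, pt α t⟫ = ⟪dir t, α.center⟫ + α.radius := by
  rw [pt, inner_add_right, inner_smul_right, inner_dir_dir, sub_self, cos_zero, mul_one]

/-- A circle `β` crossing `α` orthogonally at `pt α t` has its center on the tangent there, hence
reaches further in direction `t` by its whole radius. -/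
theorem Supports.notMem_vertices (hA : IsOrthogonal A) (hα : α ∈ A) {t : ℝ} (h : Supports A α t) :
    pt α t ∉ vertices A := by
  have hr := hA.radius_pos α hα
  have key : ∀ β ∈ A, α ≠ β → pt α t ∉ β := by
    intro β hβ hne hpβ
    have h1 := hA.inner_eq_zero hα hβ hne (pt_mem hr t) hpβ
    have h2 : pt α t - α.center = α.radius • dir t := add_sub_cancel_left _ _
    rw [h2, inner_smul_left, inner_sub_right, inner_dir_pt] at h1
    have h3 := h β hβ
    have h4 := hA.radius_pos β hβ
    simp [hr.ne'] at h1
    linarith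
  rintro ⟨γ, hγ, δ, hδ, hne, hpγ, hpδ⟩
  by_cases h : α = γ
  · exact key δ hδ (h ▸ hne) hpδ
  · exact key γ hγ h hpγ

/-- The open ray from `pt α t` in direction `t` is beyond all circles and runs into the exterior, so
it lies in the unbounded face. -/
theorem Supports.mem_frontier (hA : IsOrthogonal A) (hα : α ∈ A) {t : ℝ} (h : Supports A α t)
    (hF : IsFace A F) (hb : ¬ Bornology.IsBounded F) : pt α t ∈ frontier F := by
  have hr := hA.radius_pos α hα
  have hsub : (fun ε : ℝ => pt α t + ε • dir t) '' Ioi 0 ⊆ F := by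
    refine hF.subset_of_isPreconnected (isPreconnected_Ioi.image _ (by fun_prop)) ?_ ?_
    · rintro _ ⟨ε, hε, rfl⟩ ⟨β, hβ, hx⟩
      have hε' : (0 : ℝ) < ε := hε
      have h1 := real_inner_le_norm (dir t) (pt α t + ε • dir t - β.center)
      rw [EuclideanGeometry.mem_sphere, dist_eq_norm] at hx
      rw [hx, norm_dir, inner_sub_right, inner_add_right, inner_dir_pt, inner_smul_right,
        inner_dir_dir, sub_self, cos_zero] at h1
      have h2 := h β hβ
      linarith
    · obtain ⟨R, hR⟩ := exists_exterior A
      have hpos : 0 < |R| + ‖pt α t‖ + 1 := by positivity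
      refine ⟨_, ⟨|R| + ‖pt α t‖ + 1, hpos, rfl⟩, hR F hF hb ?_⟩
      have h1 := norm_sub_norm_le ((|R| + ‖pt α t‖ + 1) • dir t) (-pt α t)
      rw [norm_smul, norm_dir, norm_neg, Real.norm_of_nonneg hpos.le, sub_neg_eq_add,
        add_comm _ (pt α t)] at h1
      have h2 : R < ‖pt α t + (|R| + ‖pt α t‖ + 1) • dir t‖ := by
        linarith [le_abs_self R]
      exact h2
  exact hF.mem_frontier ⟨α, hα, pt_mem hr t⟩ <| mem_closure_of_forall_add_smul fun ε hε =>
    hsub ⟨ε, hε, rfl⟩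

/-- The directions in which the circle `α` bounds the face `F`, from either side. -/
def boundary (A : Finset Circ) (F : Set Plane) (α : Circ) : Set ℝ :=
  {t | pt α t ∈ frontier F \ vertices A}

theorem isOpen_boundary (hA : IsOrthogonal A) (hF : IsFace A F) (hα : α ∈ A) :
    IsOpen (boundary A F α) := by
  rw [isOpen_iff_mem_nhds]
  intro t ht
  filter_upwards [(continuous_pt α).continuousAt.eventually
    (hF.eventually_mem_frontier hA ht.2 ht.1)] with s hs
  exact ⟨hs.2 ⟨α, hα, pt_mem (hA.radius_pos α hα) s⟩, hs.1⟩

theorem isClosed_supports (A : Finset Circ) (α : Circ) : IsClosed {t | Supports A α t} := by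
  have : {t | Supports A α t} = ⋂ β ∈ A,
      {t | ⟪dir t, β.center⟫ + β.radius ≤ ⟪dir t, α.center⟫ + α.radius} := by
    ext; simp [Supports]
  rw [this]
  have := continuous_dir
  exact isClosed_biInter fun β _ => isClosed_le (by fun_prop) (by fun_prop)

/-- In every direction some circle of the finite arrangement extends furthest. -/
theorem two_pi_le_sum_supports (hne : A.Nonempty) :
    2 * π ≤ ∑ α ∈ A, volume.real ({t | Supports A α t} ∩ Ioc (-π) π) := by
  rw [← volume_real_Ioc_pi]
  refine (measureReal_mono (fun t ht => ?_) ?_).trans (measureReal_biUnion_finset_le A _)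
  · obtain ⟨α, hα, h⟩ := A.exists_max_image (fun β => ⟪dir t, β.center⟫ + β.radius) hne
    exact mem_biUnion (show α ∈ (A : Set Circ) from hα) ⟨h, ht⟩
  · exact ((measure_mono (iUnion₂_subset fun α _ => inter_subset_right)).trans_lt
      measure_Ioc_lt_top).ne

/-- Near a vertex of the unbounded face, parts of its boundary are not extremal. -/
theorem volume_supports_lt (hA : IsOrthogonal A) (hF : IsFace A F) (hb : ¬ Bornology.IsBounded F)
    (hα : α ∈ A) (hβ : β ∈ A) (hne : α ≠ β) (hvα : v ∈ α) (hvβ : v ∈ β) (hvF : v ∈ frontier F) :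
    volume.real ({t | Supports A α t} ∩ Ioc (-π) π) <
      volume.real (boundary A F α ∩ Ioc (-π) π) := by
  have hr := hA.radius_pos α hα
  obtain ⟨e, he, hve, heα⟩ := hF.exists_edge_of_mem_of_mem hA hα hβ hne hvα hvβ hvF
  -- `Supports` rewritten as a closed condition on the point instead of the angle. The vertex `v`
  -- violates it, so nearby points of the edge ending at `v` do too.
  let K : Set Plane := ⋂ γ ∈ A,
    {q | ⟪q - α.center, γ.center - α.center⟫ ≤ α.radius * (α.radius - γ.radius)}
  have hK : IsClosed K := isClosed_biInter fun γ _ => isClosed_le (by fun_prop) (by fun_prop)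
  have hKs : ∀ t, pt α t ∈ K ↔ Supports A α t := by
    intro t
    simp only [K, mem_iInter, mem_ofPred_eq, Supports]
    refine forall₂_congr fun γ hγ => ?_
    rw [show pt α t - α.center = α.radius • dir t from add_sub_cancel_left _ _, inner_smul_left,
      inner_sub_right]
    simp only [conj_trivial]
    rw [mul_le_mul_iff_right₀ hr]
    constructor <;> intro h <;> linarith
  have hvK : v ∉ K := by
    obtain ⟨s, -, rfl⟩ := exists_eq_pt hvα
    rw [hKs]
    exact fun h => h.notMem_vertices hA hα ⟨α, hα, β, hβ, hne, hvα, hvβ⟩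
  obtain ⟨q, hqK, hqe⟩ := mem_closure_iff.1 hve Kᶜ hK.isOpen_compl hvK
  obtain ⟨t, ht, rfl⟩ := exists_eq_pt (heα q hqe)
  have hO : IsOpen (boundary A F α \ {t | Supports A α t}) :=
    (isOpen_boundary hA hF hα).sdiff (isClosed_supports A α)
  have htO : t ∈ boundary A F α \ {t | Supports A α t} :=
    ⟨⟨he.2 hqe, (he.1.subset hqe).2⟩, fun h => hqK ((hKs t).2 h)⟩
  -- The angle may be `π`, but the open set around it still meets the open interval.
  have hcl : t ∈ closure (Ioo (-π) π) := by
    rw [closure_Ioo (by linarith [pi_pos])]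
    exact ⟨ht.1.le, ht.2⟩
  have hpos := (hO.inter isOpen_Ioo).measure_pos volume (mem_closure_iff.1 hcl _ hO htO)
  have hsub : ({t | Supports A α t} ∩ Ioc (-π) π) ∪
      ((boundary A F α \ {t | Supports A α t}) ∩ Ioo (-π) π) ⊆ boundary A F α ∩ Ioc (-π) π := by
    rintro s (⟨h1, h2⟩ | ⟨h1, h2⟩)
    · exact ⟨⟨Supports.mem_frontier hA hα h1 hF hb, Supports.notMem_vertices hA hα h1⟩, h2⟩
    · exact ⟨h1.1, Ioo_subset_Ioc_self h2⟩
  have hfin : ∀ s : Set ℝ, s ⊆ Ioc (-π) π → volume s ≠ ⊤ := fun s hs =>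
    ((measure_mono hs).trans_lt measure_Ioc_lt_top).ne
  have h1 := measureReal_mono (μ := volume) hsub (hfin _ inter_subset_right)
  rw [measureReal_union (disjoint_left.2 fun s h1 h2 => h2.1.2 h1.1)
    (hO.inter isOpen_Ioo).measurableSet (hfin _ inter_subset_right)
    (hfin _ fun s hs => Ioo_subset_Ioc_self hs.2)] at h1
  have h2 : 0 < volume.real ((boundary A F α \ {t | Supports A α t}) ∩ Ioo (-π) π) :=
    ENNReal.toReal_pos hpos.ne' (hfin _ fun s hs => Ioo_subset_Ioc_self hs.2)
  linarith

/-- A circle that meets the boundary of a face without vertices is contained in it. -/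
theorem IsFace.pt_mem_frontier (hA : IsOrthogonal A) (hF : IsFace A F)
    (hv : vertices A ∩ frontier F = ∅) (hα : α ∈ A) (hp : p ∈ α) (hpF : p ∈ frontier F) (t : ℝ) :
    pt α t ∈ frontier F \ vertices A := by
  have hn : ∀ x ∈ frontier F, x ∉ vertices A := fun x hx hxv =>
    (eq_empty_iff_forall_notMem.1 hv) x ⟨hxv, hx⟩
  have heq : boundary A F α = pt α ⁻¹' frontier F := by
    ext t; exact ⟨fun h => h.1, fun h => ⟨h, hn _ h⟩⟩
  have hclopen : IsClopen (boundary A F α) :=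
    ⟨heq ▸ isClosed_frontier.preimage (continuous_pt α), isOpen_boundary hA hF hα⟩
  obtain ⟨s, -, rfl⟩ := exists_eq_pt hp
  have := hclopen.eq_univ ⟨s, hpF, hn _ hpF⟩
  exact (this ▸ mem_univ t : t ∈ boundary A F α)

/-- The boundary of an unbounded face with at least two edges has total angle more than `2π`. -/
theorem IsFace.two_pi_lt (hA : IsOrthogonal A) (hF : IsFace A F) (hb : ¬ Bornology.IsBounded F)
    (hE : (boundingEdges A F).Nontrivial) :
    2 * π < ∑ α ∈ A, volume.real (boundary A F α ∩ Ioc (-π) π) := by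
  obtain ⟨e₁, he₁, e₂, he₂, hne⟩ := hE
  obtain ⟨p₁, hp₁⟩ := he₁.1.nonempty
  obtain ⟨p₂, hp₂⟩ := he₂.1.nonempty
  obtain ⟨α₁, hα₁, hpα₁⟩ := (he₁.1.subset hp₁).1
  obtain ⟨α₂, hα₂, hpα₂⟩ := (he₂.1.subset hp₂).1
  have hfin : ∀ s : Set ℝ, s ⊆ Ioc (-π) π → volume s ≠ ⊤ := fun s hs =>
    ((measure_mono hs).trans_lt measure_Ioc_lt_top).ne
  rcases (vertices A ∩ frontier F).eq_empty_or_nonempty with hv | ⟨v, hv, hvF⟩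
  -- Without vertices, the two edges are two whole circles, with total angle `4π`.
  · have h1 := hF.pt_mem_frontier hA hv hα₁ hpα₁ (he₁.2 hp₁)
    have h2 := hF.pt_mem_frontier hA hv hα₂ hpα₂ (he₂.2 hp₂)
    have hcirc : α₁ ≠ α₂ := by
      rintro rfl
      have hc : IsPreconnected (range (pt α₁)) := isPreconnected_range (continuous_pt α₁)
      have hsub : range (pt α₁) ⊆ skeleton A \ vertices A := by
        rintro _ ⟨t, rfl⟩
        exact ⟨⟨α₁, hα₁, pt_mem (hA.radius_pos α₁ hα₁) t⟩, (h1 t).2⟩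
      obtain ⟨s₁, -, hs₁⟩ := exists_eq_pt hpα₁
      obtain ⟨s₂, -, hs₂⟩ := exists_eq_pt hpα₂
      have hr₁ := he₁.1.subset_of_isPreconnected hc hsub ⟨p₁, ⟨s₁, hs₁.symm⟩, hp₁⟩
      exact hne (he₁.1.eq_of_inter he₂.1 ⟨p₂, hr₁ ⟨s₂, hs₂.symm⟩, hp₂⟩)
    have e1 : boundary A F α₁ ∩ Ioc (-π) π = Ioc (-π) π := inter_eq_right.2 fun t _ => h1 t
    have e2 : boundary A F α₂ ∩ Ioc (-π) π = Ioc (-π) π := inter_eq_right.2 fun t _ => h2 t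
    have h3 := Finset.add_le_sum (s := A)
      (f := fun α => volume.real (boundary A F α ∩ Ioc (-π) π))
      (fun _ _ => measureReal_nonneg) hα₁ hα₂ hcirc
    simp only [e1, e2, volume_real_Ioc_pi] at h3
    linarith [pi_pos]
  · obtain ⟨α, hα, β, hβ, hne', hvα, hvβ⟩ := hv
    refine (two_pi_le_sum_supports ⟨α, hα⟩).trans_lt
      (Finset.sum_lt_sum (fun γ hγ => measureReal_mono ?_ (hfin _ inter_subset_right))
        ⟨α, hα, volume_supports_lt hA hF hb hα hβ hne' hvα hvβ hvF⟩)
    rintro t ⟨h1, h2⟩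
    exact ⟨⟨Supports.mem_frontier hA hγ h1 hF hb, Supports.notMem_vertices hA hγ h1⟩, h2⟩

/-! ### Neighbors of the unbounded face and the final count. -/

/-- The faces that lie inside a circle and share an edge on that circle with `F`. -/
def innerNeighbors (A : Finset Circ) (F : Set Plane) : Set (Set Plane) :=
  {G | IsFace A G ∧ ∃ α ∈ A, (∀ x ∈ G, power α x < 0) ∧
    ∃ p ∈ α, p ∉ vertices A ∧ p ∈ frontier F ∧ p ∈ frontier G}

/-- A shared edge determines the neighbor: the edge lies on only one circle, and that circle has one
face at the inner side of the edge. -/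
theorem IsFace.encard_innerNeighbors_le (hA : IsOrthogonal A) (hF : IsFace A F) :
    (innerNeighbors A F).encard ≤ (boundingEdges A F).encard := by
  have h : ∀ G ∈ innerNeighbors A F, ∃ e ∈ boundingEdges A F, ∃ α ∈ A,
      (∀ x ∈ G, power α x < 0) ∧ (∀ x ∈ e, x ∈ α) ∧ e ⊆ frontier G := by
    rintro G ⟨hG, α, hα, hGα, p, hpα, hpv, hpF, hpG⟩
    obtain ⟨e, he, hpe⟩ := IsEdge.exists_of_mem ⟨α, hα, hpα⟩ hpv
    exact ⟨e, ⟨he, he.subset_frontier hA hF hpe hpF⟩, α, hα, hGα, he.mem_circ_of_mem hα hpe hpα,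
      he.subset_frontier hA hG hpe hpG⟩
  choose! f hf c hc hcG hfc hfG using h
  refine encard_le_encard_of_injOn (f := f) hf fun G hG G' hG' hGG => ?_
  obtain ⟨q, hq⟩ := (hf G hG).1.nonempty
  have hqv := ((hf G hG).1.subset hq).2
  have hq' : q ∈ f G' := hGG ▸ hq
  have hcc : c G = c G' := by
    by_contra hne
    exact hqv ⟨_, hc G hG, _, hc G' hG', hne, hfc G hG q hq, hfc G' hG' q hq'⟩
  refine hG.1.eq_of_mem_frontier hA hG'.1 (hc G hG) (hfc G hG q hq) hqv (hfG G hG hq)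
    (hfG G' hG' hq') (Or.inr rfl) (fun x hx => by have := hcG G hG x hx; linarith)
    (fun x hx => by have := hcG G' hG' x hx; rw [hcc]; linarith)

/-- Whichever side of the arc `F` is on, the face at its inner side is an inner neighbor, and the
arc counts among the normals of that face. -/
theorem sum_boundary_le (hA : IsOrthogonal A) {𝒩 : Finset (Set Plane)}
    (hN : innerNeighbors A F ⊆ 𝒩) :
    ∑ α ∈ A, volume.real (boundary A F α ∩ Ioc (-π) π) ≤
      ∑ G ∈ 𝒩, ∑ α ∈ A, volume.real (normals A G α) := by
  rw [Finset.sum_comm]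
  refine Finset.sum_le_sum fun α hα => ?_
  refine (measureReal_mono (fun t ht => ?_) ?_).trans (measureReal_biUnion_finset_le 𝒩 _)
  · have hpt := pt_mem (hA.radius_pos α hα) t
    obtain ⟨G, hG, hpG, hGs⟩ := hA.exists_face hα hpt ht.1.2 (Or.inr rfl : (-1 : ℝ) = 1 ∨ _)
    have hGs' : ∀ x ∈ G, power α x < 0 := fun x hx => by have := hGs x hx; linarith
    exact mem_biUnion (show G ∈ (𝒩 : Set (Set Plane)) from
      hN ⟨hG, α, hα, hGs', _, hpt, ht.1.2, ht.1.1, hpG⟩) ⟨ht.2, hGs', hpG, ht.1.2⟩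
  · exact ((measure_mono (iUnion₂_subset fun G _ t ht => ht.1)).trans_lt measure_Ioc_lt_top).ne

/-- The faces with `k` edges, other than the unbounded face and its neighbors, fit into the angle
that is left. -/
theorem IsOrthogonal.card_bound (hA : IsOrthogonal A) {k : ℕ} (hk : 2 ≤ k)
    {𝒟 : Finset (Set Plane)}
    (hD : ∀ F ∈ 𝒟, IsFace A F ∧ (boundingEdges A F).encard = k) :
    𝒟.card * (2 * π - k * (π / 2)) ≤ 2 * π * A.card ∨
      ∃ m : ℕ, 𝒟.card ≤ m + k + 1 ∧ m * (2 * π - k * (π / 2)) < 2 * π * A.card - 2 * π := by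
  classical
  have hP : ∀ F ∈ 𝒟, Bornology.IsBounded F →
      2 * π - k * (π / 2) ≤ ∑ α ∈ A, volume.real (normals A F α) := fun F hF hb =>
    (hD F hF).1.two_pi_le hA hb ((hD F hF).1.ncard_vertices_le hA (hD F hF).2)
  by_cases hall : ∀ F ∈ 𝒟, Bornology.IsBounded F
  · left
    rw [← nsmul_eq_mul]
    exact (Finset.card_nsmul_le_sum _ _ _ fun F hF => hP F hF (hall F hF)).trans
      (hA.sum_normals_le fun F hF => (hD F hF).1)
  right
  push Not at hall
  obtain ⟨F, hF, hb⟩ := hall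
  have hle := (hD F hF).1.encard_innerNeighbors_le hA
  rw [(hD F hF).2] at hle
  have hfin : (innerNeighbors A F).Finite := finite_of_encard_le_coe hle
  have hNk : hfin.toFinset.card ≤ k := by
    rw [hfin.encard_eq_coe_toFinset_card] at hle
    exact_mod_cast hle
  set 𝒩 := hfin.toFinset with hNdef
  have hM := (hD F hF).1.two_pi_lt hA hb (by
    rw [← one_lt_encard_iff_nontrivial, (hD F hF).2]
    exact_mod_cast hk)
  have hMN := sum_boundary_le hA (F := F) (𝒩 := 𝒩) (by simp [hNdef])
  -- The neighbors in `𝒩`, whether or not they have `k` edges, take more than `2π` of the budget;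
  -- what is left must suffice for `𝒟'`.
  set 𝒟' := 𝒟.erase F \ 𝒩 with hD'
  refine ⟨𝒟'.card, ?_, ?_⟩
  · have h1 : (𝒟.erase F).card ≤ 𝒟'.card + 𝒩.card := Finset.card_le_card_sdiff_add_card
    have h2 := Finset.card_erase_add_one hF
    omega
  · have h1 := hA.sum_normals_le (𝒟 := 𝒟' ∪ 𝒩) (fun G hG => by
      rcases Finset.mem_union.1 hG with h | h
      · exact (hD G (Finset.mem_of_mem_erase (Finset.mem_sdiff.1 h).1)).1
      · exact (hfin.mem_toFinset.1 h).1)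
    rw [Finset.sum_union Finset.sdiff_disjoint] at h1
    have h2 := Finset.card_nsmul_le_sum 𝒟' (fun G => ∑ α ∈ A, volume.real (normals A G α))
      (2 * π - k * (π / 2)) (fun G hG => by
        have hG' := Finset.mem_erase.1 (Finset.mem_sdiff.1 hG).1
        refine hP G hG'.2 ?_
        by_contra hGb
        exact hG'.1 ((hD G hG'.2).1.eq_of_not_isBounded (hD F hF).1 hGb hb))
    rw [nsmul_eq_mul] at h2
    linarith

/-- Reduces the bounds to finite families of faces, so that the finiteness of the set of faces is
never needed. -/
theorem _root_.Set.encard_le_of_forall_finset {X : Type*} {s : Set X} {N : ℕ}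
    (h : ∀ t : Finset X, (t : Set X) ⊆ s → t.card ≤ N) : s.encard ≤ N := by
  by_contra! hc
  obtain ⟨t, ht, htc⟩ := exists_subset_encard_eq (k := ((N + 1 : ℕ) : ℕ∞)) (s := s)
    (by exact_mod_cast Order.add_one_le_of_lt hc)
  have hfin : t.Finite := finite_of_encard_eq_coe htc
  have h1 := h hfin.toFinset (by simpa using ht)
  rw [hfin.encard_eq_coe_toFinset_card] at htc
  have : hfin.toFinset.card = N + 1 := by exact_mod_cast htc
  omega

theorem IsOrthogonal.encard_digonalFaces_le (hA : IsOrthogonal A) :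
    (digonalFaces A).encard ≤ ((2 * A.card : ℕ) : ℕ∞) := by
  refine Set.encard_le_of_forall_finset fun t ht => ?_
  rcases hA.card_bound (k := 2) le_rfl (𝒟 := t) (fun F hF => ht hF) with h | ⟨m, hm, h⟩
  · have h1 : (t.card : ℝ) ≤ 2 * A.card := by
      refine le_of_mul_le_mul_right (a := π) ?_ pi_pos
      push_cast at h; linarith
    exact_mod_cast h1
  -- Strictness matters here: `m ≤ 2n - 3`, and the `k + 1 = 3` discarded faces bring the count to
  -- exactly `2n` at most.
  · have h1 : (m : ℝ) + 2 < 2 * A.card := by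
      refine lt_of_mul_lt_mul_right (a := π) ?_ pi_pos.le
      push_cast at h; linarith
    have h2 : m + 2 < 2 * A.card := by exact_mod_cast h1
    omega

theorem IsOrthogonal.encard_triangularFaces_le (hA : IsOrthogonal A) :
    (triangularFaces A).encard ≤ ((4 * A.card : ℕ) : ℕ∞) := by
  refine Set.encard_le_of_forall_finset fun t ht => ?_
  rcases hA.card_bound (k := 3) (by norm_num) (𝒟 := t) (fun F hF => ht hF) with h | ⟨m, hm, h⟩
  · have h1 : (t.card : ℝ) ≤ 4 * A.card := by
      refine le_of_mul_le_mul_right (a := π) ?_ pi_pos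
      push_cast at h; linarith
    exact_mod_cast h1
  · have h1 : (m : ℝ) + 4 < 4 * A.card := by
      refine lt_of_mul_lt_mul_right (a := π) ?_ pi_pos.le
      push_cast at h; linarith
    have h2 : m + 4 < 4 * A.card := by exact_mod_cast h1
    omega

end CircleArrangement

theorem mainTheorem4 (n : ℕ) (A : Finset CircleArrangement.Circ) (hn : A.card = n)
    (hA : CircleArrangement.IsOrthogonal A) :
    (CircleArrangement.digonalFaces A).encard ≤ ((2 * n : ℕ) : ℕ∞) ∧
      (CircleArrangement.triangularFaces A).encard ≤ ((4 * n : ℕ) : ℕ∞) := by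
  subst hn
  exact ⟨hA.encard_digonalFaces_le, hA.encard_triangularFaces_le⟩
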